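/- Let $G$ be a Lie group with Lie algebra $\mathfrak g$, let $H\subset G$ be a closed subgroup with Lie algebra $\mathfrak h$, let $M=G/H$ be the smooth coset space with origin $o=eH$ and projection $\pi:G\to G/H$, and let $\mathfrak g=\mathfrak h+\mathfrak m$ be a linear decomposition (direct sum of vector spaces, not necessarily reductive). Identify $\mathfrak m$ with $T_o(G/H)$ through $\pi_*$, and denote by $[\cdot,\cdot]_{\mathfrak m}$ the $\mathfrak m$-component of the Lie bracket of $\mathfrak g$. A spray structure on a manifold $M$ is a smooth vector field $\mathbf G$ on $TM\setminus 0$ which, in the coordinates $(x^i,y^j)$ of $TM$ induced by any chart of $M$, has the form $\mathbf G=y^i\partial_{x^i}-2\mathbf G^i\partial_{y^i}$ with $\mathbf G^i(x,\lambda y)=\lambda^2\mathbf G^i(x,y)$ for all $\lambda>0$. Its geodesics are the smooth curves $c$ with nowhere-vanishing $\dot c$ such that $(c(t),\dot c(t))$ is an integral curve of $\mathbf G$. A nowhere-vanishing smooth vector field $Y(t)=Y^i(t)\partial_{x^i}|_{c(t)}$ along a smooth curve $c(t)$ is nonlinearly parallel if, in all such coordinates, $$\tfrac{d}{dt}Y^i(t)+\dot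 c^j(t)\,\mathbf N^i_j(c(t),Y(t))=0\quad\text{for all } i,\qquad \mathbf N^i_j=\tfrac{\partial \mathbf G^i}{\partial y^j}.$$ Let $\mathbf G$ be a $G$-invariant spray structure on $G/H$, i.e. $(g_*)_*\mathbf G=\mathbf G$ for all $g\in G$. For a smooth curve $c$ on $G/H$ with $c(0)=o$ and nowhere-vanishing $\dot c$, a lift of $c$ is a smooth curve $\bar c$ on $G$ with $\bar c(0)=e$, $c(t)=\bar c(t)\cdot o$ and $(L_{\bar c(t)^{-1}})_*\dot{\bar c}(t)\in\mathfrak m\setminus\{0\}$ for all $t$. The spray vector field $\eta:\mathfrak m\setminus\{0\}\to\mathfrak m$ is defined by $\eta(y)=-\tfrac{d}{dt}\big|_{t=0}(L_{\bar c_y(t)^{-1}})_*\dot{\bar c}_y(t)$, where $c_y$ is the geodesic with $c_y(0)=o$, $\dot c_y(0)=y$, and $\bar c_y$ is its lift, defined for $t$ near $0$. The connection operator $N:(\mathfrak m\setminus\{0\})\times\mathfrak m\to\mathfrak m$ is $$N(y,u)=\tfrac12D\eta(y,u)-\tfrac12[y,u]_{\mathfrak m},\qquad D\eta(y,u)=\tfrac{d}{dt}\Big|_{t=0}\eta(y+tu).$$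 Theorem. Let $c(t)$ be a smooth curve on $G/H$ with $c(0)=o$ and nowhere-vanishing $\dot c(t)$, let $\bar c(t)$ be its lift, where $t$ ranges over an open interval containing $0$ on which both $c$ and $\bar c$ are defined, and put $w(t)=(L_{\bar c(t)^{-1}})_*\dot{\bar c}(t)\in\mathfrak m\setminus\{0\}$. Let $Y(t)=(\bar c(t))_*(y(t))$, with $y(t)\in\mathfrak m$, be a nowhere-vanishing smooth vector field along $c(t)$. Then $Y(t)$ is nonlinearly parallel along $c(t)$ if and only if $$\tfrac{d}{dt}y(t)+N(y(t),w(t))=0$$ for all $t$. -/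

import Mathlib

open Set Topology
open scoped Manifold ContDiff

namespace HomogeneousSpray

noncomputable section

/-! ### Spray structures on a manifold -/

section Spray

variable {F : Type*} [NormedAddCommGroup F] [NormedSpace ℝ F]
  {M : Type*} [TopologicalSpace M] [ChartedSpace F M]

/-- The tangent vector `(c(t), ċ(t))` of a curve, as a point of the tangent bundle. -/
def velocity (c : ℝ → M) (t : ℝ) : TangentBundle 𝓘(ℝ, F) M :=
  ⟨c t, mfderiv 𝓘(ℝ, ℝ) 𝓘(ℝ, F) c t (1 : ℝ)⟩

/-- The slit tangent bundle `TM \ 0`. -/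
def slit (F M : Type*) [NormedAddCommGroup F] [NormedSpace ℝ F]
    [TopologicalSpace M] [ChartedSpace F M] : Set (TangentBundle 𝓘(ℝ, F) M) :=
  {p | p.2 ≠ 0}

/-- The standard local coordinates `(x, y)` on `TM` induced by a chart `e` of `M`: the point
`(p, v)` has coordinates `x = e p` and `y = de_p v`. -/
def tangentChart (e : OpenPartialHomeomorph M F) (p : TangentBundle 𝓘(ℝ, F) M) : F × F :=
  (e p.1, mfderiv 𝓘(ℝ, F) 𝓘(ℝ, F) e p.1 p.2)

/-- The point of `TM` with standard local coordinates `(x, y)`. -/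
def tangentChartSymm (e : OpenPartialHomeomorph M F) (x y : F) : TangentBundle 𝓘(ℝ, F) M :=
  ⟨e.symm x, mfderiv 𝓘(ℝ, F) 𝓘(ℝ, F) e.symm x y⟩

variable [IsManifold 𝓘(ℝ, F) ∞ M]

/-- The components with respect to `∂_x` and `∂_y` of a tangent vector `ξ` of `TM` at `p`, in the
standard local coordinates induced by `e`. -/
def components (e : OpenPartialHomeomorph M F) (p : TangentBundle 𝓘(ℝ, F) M)
    (ξ : TangentSpace 𝓘(ℝ, F).tangent p) : F × F :=
  mfderiv 𝓘(ℝ, F).tangent 𝓘(ℝ, F × F) (tangentChart e) p ξ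

/-- The coefficients `𝐆(x, y)` of a vector field on `TM` which is locally presented as
`y^i ∂_{x^i} - 2 𝐆^i(x, y) ∂_{y^i}`. -/
def coefficient (S : (p : TangentBundle 𝓘(ℝ, F) M) → TangentSpace 𝓘(ℝ, F).tangent p)
    (e : OpenPartialHomeomorph M F) (x y : F) : F :=
  -(1 / 2 : ℝ) • (components e (tangentChartSymm e x y) (S (tangentChartSymm e x y))).2

variable (F M) in
/-- A spray structure on `M`: a smooth vector field on the slit tangent bundle, which in all
standard local coordinates is `y^i ∂_{x^i} - 2 𝐆^i ∂_{y^i}` with `𝐆^i(x, y)` positively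
2-homogeneous in `y`. The values of `toFun` on the zero section are irrelevant. -/
structure Spray where
  /-- The underlying vector field. -/
  toFun : (p : TangentBundle 𝓘(ℝ, F) M) → TangentSpace 𝓘(ℝ, F).tangent p
  smooth : ContMDiffOn 𝓘(ℝ, F).tangent 𝓘(ℝ, F).tangent.tangent ∞
    (fun p => (⟨p, toFun p⟩ : TangentBundle 𝓘(ℝ, F).tangent (TangentBundle 𝓘(ℝ, F) M)))
    (slit F M)
  fst_components : ∀ e ∈ IsManifold.maximalAtlas 𝓘(ℝ, F) ∞ M, ∀ p ∈ slit F M, p.1 ∈ e.source →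
    (components e p (toFun p)).1 = (tangentChart e p).2
  homogeneous : ∀ e ∈ IsManifold.maximalAtlas 𝓘(ℝ, F) ∞ M, ∀ x ∈ e.target, ∀ y : F, y ≠ 0 →
    ∀ r : ℝ, 0 < r → coefficient toFun e x (r • y) = r ^ 2 • coefficient toFun e x y

/-- A smooth curve with nowhere vanishing velocity is a geodesic of `S` if `(c(t), ċ(t))` is an
integral curve of `S`. -/
structure IsGeodesicOn (S : Spray F M) (c : ℝ → M) (J : Set ℝ) : Prop where
  smooth : ContMDiffOn 𝓘(ℝ, ℝ) 𝓘(ℝ, F) ∞ c J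
  velocity_mem : ∀ t ∈ J, velocity c t ∈ slit F M
  integral : IsMIntegralCurveOn (I := 𝓘(ℝ, F).tangent) (velocity c) S.toFun J

/-- The connection coefficients `𝐍^i_j = ∂𝐆^i/∂y^j` at `(x, y)`, as a linear map. -/
def connectionCoefficient (S : Spray F M) (e : OpenPartialHomeomorph M F) (x y : F) : F →L[ℝ] F :=
  fderiv ℝ (fun z => coefficient S.toFun e x z) y

/-- `Y` is a nowhere vanishing smooth vector field along `c`, on the parameter set `J`. -/
structure IsNonvanishingFieldAlong (c : ℝ → M) (Y : ℝ → TangentBundle 𝓘(ℝ, F) M)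
    (J : Set ℝ) : Prop where
  smooth : ContMDiffOn 𝓘(ℝ, ℝ) 𝓘(ℝ, F).tangent ∞ Y J
  proj : ∀ t ∈ J, (Y t).1 = c t
  mem_slit : ∀ t ∈ J, Y t ∈ slit F M

/-- The components `d/dt Y^i(t) + ċ^j(t) 𝐍^i_j(c(t), Y(t))` of the nonlinear covariant derivative
of `Y` along `c`, in the standard local coordinates induced by `e`. -/
def nonlinearCovariantDeriv (S : Spray F M) (e : OpenPartialHomeomorph M F) (c : ℝ → M)
    (Y : ℝ → TangentBundle 𝓘(ℝ, F) M) (t : ℝ) : F :=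
  deriv (fun s => (tangentChart e (Y s)).2) t
    + connectionCoefficient S e (e (c t)) (tangentChart e (Y t)).2 (deriv (fun s => e (c s)) t)

/-- `Y` is nonlinearly parallel along `c`: its nonlinear covariant derivative vanishes. -/
def IsNonlinearlyParallelOn (S : Spray F M) (c : ℝ → M) (Y : ℝ → TangentBundle 𝓘(ℝ, F) M)
    (J : Set ℝ) : Prop :=
  ∀ t ∈ J, ∀ e ∈ IsManifold.maximalAtlas 𝓘(ℝ, F) ∞ M, c t ∈ e.source →
    nonlinearCovariantDeriv S e c Y t = 0

end Spray

/-! ### Lie groups and coset spaces -/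

section Coset

variable {E : Type*} [NormedAddCommGroup E] [NormedSpace ℝ E]
  {F : Type*} [NormedAddCommGroup F] [NormedSpace ℝ F]
  {G : Type*} [TopologicalSpace G] [ChartedSpace E G] [Group G]

/-- `(L_{γ(t)⁻¹})_* γ̇(t)`, an element of the Lie algebra (note `γ(t)⁻¹ γ(t) = 1`). -/
def leftVelocity (γ : ℝ → G) (t : ℝ) : GroupLieAlgebra 𝓘(ℝ, E) G :=
  mfderiv 𝓘(ℝ, E) 𝓘(ℝ, E) (fun x => (γ t)⁻¹ * x) (γ t) (mfderiv 𝓘(ℝ, ℝ) 𝓘(ℝ, E) γ t (1 : ℝ))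

/-- `v` is the velocity at `0` of a smooth curve in `H` starting at the identity. -/
def IsTangentTo (H : Subgroup G) (v : GroupLieAlgebra 𝓘(ℝ, E) G) : Prop :=
  ∃ ε : ℝ, 0 < ε ∧ ∃ γ : ℝ → G, ContMDiffOn 𝓘(ℝ, ℝ) 𝓘(ℝ, E) ∞ γ (Ioo (-ε) ε) ∧
    (∀ t ∈ Ioo (-ε) ε, γ t ∈ H) ∧ velocity γ 0 = ⟨1, v⟩

theorem velocity_eq_iff {γ : ℝ → G} {v : GroupLieAlgebra 𝓘(ℝ, E) G} :
    velocity γ 0 = ⟨1, v⟩ ↔ γ 0 = 1 ∧ (mfderiv 𝓘(ℝ, ℝ) 𝓘(ℝ, E) γ 0 (1 : ℝ) : E) = (v : E) := by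
  constructor
  · intro h
    exact ⟨congrArg Bundle.TotalSpace.proj h,
      congrArg (fun p : TangentBundle 𝓘(ℝ, E) G => (p.2 : E)) h⟩
  · rintro ⟨h, h'⟩
    have key : ∀ (g g' : G) (a : E), g = g' →
        (⟨g, a⟩ : TangentBundle 𝓘(ℝ, E) G) = ⟨g', a⟩ := by
      rintro g _ a rfl
      rfl
    calc velocity γ 0 = ⟨γ 0, (v : E)⟩ := by
          rw [← h']
          rfl
      _ = ⟨1, v⟩ := key _ _ _ h

theorem IsTangentTo.zero (H : Subgroup G) : IsTangentTo H (0 : GroupLieAlgebra 𝓘(ℝ, E) G) := by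
  refine ⟨1, one_pos, fun _ => 1, contMDiffOn_const, fun _ _ => H.one_mem,
    velocity_eq_iff.2 ⟨rfl, ?_⟩⟩
  rw [mfderiv_const]
  rfl

theorem IsTangentTo.smul {H : Subgroup G} (a : ℝ) {v : GroupLieAlgebra 𝓘(ℝ, E) G}
    (hv : IsTangentTo H v) : IsTangentTo H (a • v) := by
  obtain ⟨ε, hε, γ, hγ, hH, h⟩ := hv
  obtain ⟨h1, h2⟩ := velocity_eq_iff.1 h
  have ha : 0 < |a| + 1 := by positivity
  have hmaps : ∀ t ∈ Ioo (-(ε / (|a| + 1))) (ε / (|a| + 1)), a * t ∈ Ioo (-ε) ε := by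
    intro t ht
    have ht' : |t| * (|a| + 1) < ε := (lt_div_iff₀ ha).1 (abs_lt.2 ht)
    have : |a * t| < ε := by
      rw [abs_mul]
      nlinarith [abs_nonneg t, abs_nonneg a]
    exact abs_lt.1 this
  have hlin : ContMDiff 𝓘(ℝ, ℝ) 𝓘(ℝ, ℝ) ∞ (fun t : ℝ => a * t) :=
    (contDiff_const.mul contDiff_id).contMDiff
  refine ⟨ε / (|a| + 1), by positivity, fun t => γ (a * t),
    hγ.comp hlin.contMDiffOn hmaps, fun t ht => hH _ (hmaps t ht), velocity_eq_iff.2 ?_⟩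
  refine ⟨by simpa using h1, ?_⟩
  have hd : HasMFDerivAt 𝓘(ℝ, ℝ) 𝓘(ℝ, E) γ (a * 0) (mfderiv 𝓘(ℝ, ℝ) 𝓘(ℝ, E) γ (a * 0)) := by
    have : (a * 0) ∈ Ioo (-ε) ε := by simp [hε]
    exact ((hγ.contMDiffAt (isOpen_Ioo.mem_nhds this)).mdifferentiableAt (by simp)).hasMFDerivAt
  have hl : HasMFDerivAt 𝓘(ℝ, ℝ) 𝓘(ℝ, ℝ) (fun t : ℝ => a * t) 0
      ((ContinuousLinearMap.toSpanSingleton ℝ a : ℝ →L[ℝ] ℝ)) := by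
    have : HasDerivAt (fun t : ℝ => a * t) a 0 := by
      simpa using (hasDerivAt_id (0 : ℝ)).const_mul a
    exact this.hasFDerivAt.hasMFDerivAt
  have hcomp := (hd.comp (0 : ℝ) hl).mfderiv
  have e1 : (mfderiv 𝓘(ℝ, ℝ) 𝓘(ℝ, E) (fun t : ℝ => γ (a * t)) 0 (1 : ℝ) : E)
      = (mfderiv 𝓘(ℝ, ℝ) 𝓘(ℝ, E) γ (a * 0) (a : ℝ) : E) := by
    have := congrArg (fun L : ℝ →L[ℝ] E => L 1) hcomp
    refine this.trans ?_
    change (mfderiv 𝓘(ℝ, ℝ) 𝓘(ℝ, E) γ (a * 0)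
      ((ContinuousLinearMap.toSpanSingleton ℝ a : ℝ →L[ℝ] ℝ) 1) : E) = _
    rw [ContinuousLinearMap.toSpanSingleton_apply, one_smul]
  have e2 : (mfderiv 𝓘(ℝ, ℝ) 𝓘(ℝ, E) γ (a * 0) (a : ℝ) : E)
      = a • (mfderiv 𝓘(ℝ, ℝ) 𝓘(ℝ, E) γ 0 (1 : ℝ) : E) := by
    have e3 : ∀ L : ℝ →L[ℝ] E, L a = a • L 1 := by
      intro L
      rw [← map_smul, smul_eq_mul, mul_one]
    have e4 : (a * 0 : ℝ) = 0 := mul_zero a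
    have e5 : ∀ s : ℝ, s = 0 → (mfderiv 𝓘(ℝ, ℝ) 𝓘(ℝ, E) γ s (a : ℝ) : E)
        = (mfderiv 𝓘(ℝ, ℝ) 𝓘(ℝ, E) γ 0 (a : ℝ) : E) := by
      rintro _ rfl
      rfl
    exact (e5 _ e4).trans (e3 (mfderiv 𝓘(ℝ, ℝ) 𝓘(ℝ, E) γ 0))
  rw [e1, e2, h2]
  rfl

theorem IsTangentTo.add [LieGroup 𝓘(ℝ, E) ∞ G] {H : Subgroup G}
    {v w : GroupLieAlgebra 𝓘(ℝ, E) G}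
    (hv : IsTangentTo H v) (hw : IsTangentTo H w) : IsTangentTo H (v + w) := by
  obtain ⟨ε, hε, γ, hγ, hH, h⟩ := hv
  obtain ⟨δ, hδ, κ, hκ, hH', h'⟩ := hw
  obtain ⟨h1, h2⟩ := velocity_eq_iff.1 h
  obtain ⟨h1', h2'⟩ := velocity_eq_iff.1 h'
  have s1 : Ioo (-min ε δ) (min ε δ) ⊆ Ioo (-ε) ε :=
    Ioo_subset_Ioo (neg_le_neg (min_le_left _ _)) (min_le_left _ _)
  have s2 : Ioo (-min ε δ) (min ε δ) ⊆ Ioo (-δ) δ :=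
    Ioo_subset_Ioo (neg_le_neg (min_le_right _ _)) (min_le_right _ _)
  refine ⟨min ε δ, lt_min hε hδ, fun t => γ t * κ t, (hγ.mono s1).mul (hκ.mono s2),
    fun t ht => H.mul_mem (hH t (s1 ht)) (hH' t (s2 ht)), velocity_eq_iff.2 ⟨by simp [h1, h1'], ?_⟩⟩
  have d1 : MDifferentiableAt 𝓘(ℝ, ℝ) 𝓘(ℝ, E) γ 0 :=
    (hγ.contMDiffAt (isOpen_Ioo.mem_nhds (by simp [hε]))).mdifferentiableAt (by simp)
  have d2 : MDifferentiableAt 𝓘(ℝ, ℝ) 𝓘(ℝ, E) κ 0 :=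
    (hκ.contMDiffAt (isOpen_Ioo.mem_nhds (by simp [hδ]))).mdifferentiableAt (by simp)
  have dm : MDifferentiableAt (𝓘(ℝ, E).prod 𝓘(ℝ, E)) 𝓘(ℝ, E)
      (fun p : G × G => p.1 * p.2) (γ 0, κ 0) :=
    (contMDiff_mul 𝓘(ℝ, E) ∞).mdifferentiableAt (by simp)
  have hcomp := (dm.hasMFDerivAt.comp (0 : ℝ) (d1.hasMFDerivAt.prodMk d2.hasMFDerivAt)).mfderiv
  have e1 := congrArg (fun L : ℝ →L[ℝ] E => L 1) hcomp
  refine e1.trans ?_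
  change (mfderiv (𝓘(ℝ, E).prod 𝓘(ℝ, E)) 𝓘(ℝ, E) (fun p : G × G => p.1 * p.2) (γ 0, κ 0)
    ((mfderiv 𝓘(ℝ, ℝ) 𝓘(ℝ, E) γ 0 (1 : ℝ), mfderiv 𝓘(ℝ, ℝ) 𝓘(ℝ, E) κ 0 (1 : ℝ)) : E × E) : E) = _
  refine (mfderiv_prod_eq_add_apply dm).trans ?_
  have l1 : ∀ g : G, g = 1 → ∀ (x : G) (a : E),
      (mfderiv 𝓘(ℝ, E) 𝓘(ℝ, E) (fun z : G => z * g) x a : E) = a := by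
    rintro _ rfl x a
    have hid : HasMFDerivAt 𝓘(ℝ, E) 𝓘(ℝ, E) (fun z : G => z * 1) x
        (ContinuousLinearMap.id ℝ (TangentSpace 𝓘(ℝ, E) x)) :=
      (hasMFDerivAt_id x).congr_of_eventuallyEq (Filter.Eventually.of_forall fun z => mul_one z)
    exact congrArg (fun L : E →L[ℝ] E => L a) hid.mfderiv
  have l2 : ∀ g : G, g = 1 → ∀ (x : G) (a : E),
      (mfderiv 𝓘(ℝ, E) 𝓘(ℝ, E) (fun z : G => g * z) x a : E) = a := by
    rintro _ rfl x a
    have hid : HasMFDerivAt 𝓘(ℝ, E) 𝓘(ℝ, E) (fun z : G => 1 * z) x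
        (ContinuousLinearMap.id ℝ (TangentSpace 𝓘(ℝ, E) x)) :=
      (hasMFDerivAt_id x).congr_of_eventuallyEq (Filter.Eventually.of_forall fun z => one_mul z)
    exact congrArg (fun L : E →L[ℝ] E => L a) hid.mfderiv
  refine (congrArg₂ (fun a b : E => a + b) (l1 _ h1' _ _) (l2 _ h1 _ _)).trans ?_
  exact congrArg₂ (fun a b : E => a + b) h2 h2'

variable (E) in
/-- The Lie algebra `𝔥 ⊆ 𝔤` of a (closed) subgroup `H` of the Lie group `G`: the tangent space of
`H` at the identity. -/
def subgroupLieAlgebra [LieGroup 𝓘(ℝ, E) ∞ G] (H : Subgroup G) :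
    Submodule ℝ (GroupLieAlgebra 𝓘(ℝ, E) G) where
  carrier := {v | IsTangentTo H v}
  zero_mem' := IsTangentTo.zero H
  add_mem' := IsTangentTo.add
  smul_mem' := fun a _ hv => IsTangentTo.smul a hv

variable (H : Subgroup G) [ChartedSpace F (G ⧸ H)]

variable (E F) in
/-- The given smooth structure on `G ⧸ H` is that of the smooth coset space, i.e. the (unique) one
for which the projection `G → G ⧸ H` is a smooth submersion. -/
def IsSmoothCosetSpace : Prop :=
  Manifold.IsSubmersion 𝓘(ℝ, E) 𝓘(ℝ, F) ∞ (QuotientGroup.mk : G → G ⧸ H)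

/-- The origin `o = eH` of `G ⧸ H`. -/
def origin : G ⧸ H := QuotientGroup.mk 1

/-- The identification of `v ∈ 𝔤` (usually `v ∈ 𝔪`) with a tangent vector of `G ⧸ H` at `o`. -/
def toOrigin (v : GroupLieAlgebra 𝓘(ℝ, E) G) : TangentBundle 𝓘(ℝ, F) (G ⧸ H) :=
  tangentMap 𝓘(ℝ, E) 𝓘(ℝ, F) (QuotientGroup.mk : G → G ⧸ H) ⟨1, v⟩

variable {H}

/-- The tangent map `g_*` of the action of `g ∈ G` on `G ⧸ H`. -/
def push (g : G) : TangentBundle 𝓘(ℝ, F) (G ⧸ H) → TangentBundle 𝓘(ℝ, F) (G ⧸ H) :=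
  tangentMap 𝓘(ℝ, F) 𝓘(ℝ, F) (fun x : G ⧸ H => g • x)

/-- The spray structure is `G`-invariant (so that `G ⧸ H` is a homogeneous spray manifold):
`(g_*)_* S = S` on the slit tangent bundle, for all `g ∈ G`. -/
def IsInvariant [IsManifold 𝓘(ℝ, F) ∞ (G ⧸ H)] (S : Spray F (G ⧸ H)) : Prop :=
  ∀ g : G, ∀ p ∈ slit F (G ⧸ H),
    mfderiv 𝓘(ℝ, F).tangent 𝓘(ℝ, F).tangent (push g) p (S.toFun p) = S.toFun (push g p)

/-- `γ` is the smooth lift of the curve `c` to `G` with `γ(0) = e`, `c(t) = γ(t) · o` and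
`(L_{γ(t)⁻¹})_* γ̇(t) ∈ 𝔪 \ {0}` for all `t ∈ J`. -/
structure IsLiftOn (m : Submodule ℝ (GroupLieAlgebra 𝓘(ℝ, E) G)) (c : ℝ → G ⧸ H) (γ : ℝ → G)
    (J : Set ℝ) : Prop where
  smooth : ContMDiffOn 𝓘(ℝ, ℝ) 𝓘(ℝ, E) ∞ γ J
  zero : γ 0 = 1
  proj : ∀ t ∈ J, c t = γ t • origin H
  mem : ∀ t ∈ J, leftVelocity γ t ∈ m
  ne_zero : ∀ t ∈ J, leftVelocity γ t ≠ (0 : GroupLieAlgebra 𝓘(ℝ, E) G)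

variable [IsManifold 𝓘(ℝ, F) ∞ (G ⧸ H)]

/-- `v = - d/dt|_{t=0} y(t)`, where `y(t) = (L_{γ(t)⁻¹})_* γ̇(t)` for the lift `γ` of a geodesic `c`
with `c(0) = o` and `ċ(0) = y`. -/
def IsSprayVector (S : Spray F (G ⧸ H)) (m : Submodule ℝ (GroupLieAlgebra 𝓘(ℝ, E) G))
    (y v : m) : Prop :=
  ∃ ε : ℝ, 0 < ε ∧ ∃ (c : ℝ → G ⧸ H) (γ : ℝ → G),
    IsGeodesicOn S c (Ioo (-ε) ε) ∧ c 0 = origin H ∧ velocity (F := F) c 0 = toOrigin H (y : GroupLieAlgebra 𝓘(ℝ, E) G) ∧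
    IsLiftOn m c γ (Ioo (-ε) ε) ∧
    HasDerivAt (fun t => (leftVelocity γ t : GroupLieAlgebra 𝓘(ℝ, E) G))
      (-(v : GroupLieAlgebra 𝓘(ℝ, E) G)) 0

open Classical in
/-- The spray vector field `η : 𝔪 \ {0} → 𝔪`; its value at `0` is irrelevant. -/
def sprayVectorField (S : Spray F (G ⧸ H)) (m : Submodule ℝ (GroupLieAlgebra 𝓘(ℝ, E) G))
    (y : m) : m :=
  if h : ∃ v, IsSprayVector S m y v then h.choose else 0

/-- The connection operator `N(y, u) = ½ Dη(y, u) - ½ [y, u]_𝔪` for `y ∈ 𝔪 \ {0}`, `u ∈ 𝔪`, where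
`Dη(y, u) = d/dt|_{t=0} η(y + t u)` and `[y, u]_𝔪` is the `𝔪`-component of `[y, u]` in
`𝔤 = 𝔥 + 𝔪`. -/
def connectionOperator [LieGroup 𝓘(ℝ, E) ∞ G] (S : Spray F (G ⧸ H))
    (m : Submodule ℝ (GroupLieAlgebra 𝓘(ℝ, E) G)) (hm : IsCompl (subgroupLieAlgebra E H) m)
    (y u : m) : m :=
  (1 / 2 : ℝ) • deriv (fun t : ℝ => sprayVectorField S m (y + t • u)) 0
    - (1 / 2 : ℝ) • m.projectionOnto (subgroupLieAlgebra E H) hm.symm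
        ⁅(y : GroupLieAlgebra 𝓘(ℝ, E) G), (u : GroupLieAlgebra 𝓘(ℝ, E) G)⁆

end Coset

end

end HomogeneousSpray

open HomogeneousSpray

namespace HomogeneousSpray

noncomputable section

/-! Pull a chart `e` of `G/H` back to the function `φ = e ∘ π` on `G` and differentiate it along
left invariant fields. Write `A_g v = X_v φ (g)` and `D_g(v, u) = X_v X_u φ (g)`. The kernel of
`A_g` is exactly `𝔥` (`leftDeriv_cosetChart_eq_zero_iff`), so `A_g` restricts to an isomorphism from
`𝔪` onto the model space, and `A_g y` is the coordinate expression of `g_* y`. The antisymmetric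
part of `D` is the bracket: `D_g(v, u) - D_g(u, v) = A_g [v, u]` (`leftDeriv_leftDeriv_sub`).

For a curve `γ` in `G` with left velocity `w`, the chart curve `e ∘ π ∘ γ` has velocity `A w` and
acceleration `D(w, w) + A w'`. The geodesic equation at a point where `w = y` and `w' = -v` thus
reads `D_g(y, y) - A_g v = -2 𝐆(A_g y)`, which is `SprayEquation`. At a fixed `g` it determines `v ∈
𝔪`. By invariance of the spray the same pair `(y, v)` solves it at every `g`, so `v = η(y)`
everywhere (`exists_sprayVectorField_eq`).

Differentiating this identity in `y` in the direction `u` gives the connection coefficients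
(`connectionCoefficient_leftDeriv`): `𝐍(A y)(A u) = -½ (D(u, y) + D(y, u) - A Dη(y, u))`. The
coordinates of `Y = γ_* y` are `A y`, with derivative `D(w, y) + A y'`. Adding `𝐍(A y)(A w)` leaves
`A (y' + ½ Dη(y, w)) - ½ (D(y, w) - D(w, y))`, that is `A (y' + ½ Dη(y, w) - ½ [y, w])`. Since `A`
kills `𝔥`, only `[y, w]_𝔪` counts, so the covariant derivative is `A (y' + N(y, w))`
(`nonlinearCovariantDeriv_push`). Injectivity of `A` on `𝔪` concludes. -/

theorem eq_smulRight_one_of_apply_one {V : Type*} [NormedAddCommGroup V] [NormedSpace ℝ V]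
    {L : ℝ →L[ℝ] V} {v : V} (h : L 1 = v) : L = (1 : ℝ →L[ℝ] ℝ).smulRight v := by
  refine ContinuousLinearMap.ext_ring ?_
  simpa using h

/-! ### Induced coordinates on the tangent bundle and the geodesic equation in a chart -/

section TangentChart

variable {F : Type*} [NormedAddCommGroup F] [NormedSpace ℝ F]
  {M : Type*} [TopologicalSpace M] [ChartedSpace F M]
  {e : OpenPartialHomeomorph M F}

theorem mdifferentiableAt_of_mem_maximalAtlas (he : e ∈ IsManifold.maximalAtlas 𝓘(ℝ, F) ∞ M)
    {x : M} (hx : x ∈ e.source) : MDifferentiableAt 𝓘(ℝ, F) 𝓘(ℝ, F) e x :=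
  ((contMDiffOn_of_mem_maximalAtlas he).contMDiffAt
    (e.open_source.mem_nhds hx)).mdifferentiableAt (by simp)

theorem mdifferentiableAt_symm_of_mem_maximalAtlas
    (he : e ∈ IsManifold.maximalAtlas 𝓘(ℝ, F) ∞ M)
    {x : F} (hx : x ∈ e.target) : MDifferentiableAt 𝓘(ℝ, F) 𝓘(ℝ, F) e.symm x :=
  ((contMDiffOn_symm_of_mem_maximalAtlas he).contMDiffAt
    (e.open_target.mem_nhds hx)).mdifferentiableAt (by simp)

theorem mdifferentiable_of_mem_maximalAtlas (he : e ∈ IsManifold.maximalAtlas 𝓘(ℝ, F) ∞ M) :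
    e.MDifferentiable 𝓘(ℝ, F) 𝓘(ℝ, F) :=
  ⟨fun _ hx => (mdifferentiableAt_of_mem_maximalAtlas he hx).mdifferentiableWithinAt,
    fun _ hx => (mdifferentiableAt_symm_of_mem_maximalAtlas he hx).mdifferentiableWithinAt⟩

theorem mfderiv_chart_comp (he : e ∈ IsManifold.maximalAtlas 𝓘(ℝ, F) ∞ M) {c : ℝ → M} {t : ℝ}
    (hc : MDifferentiableAt 𝓘(ℝ, ℝ) 𝓘(ℝ, F) c t) (ht : c t ∈ e.source) :
    HasDerivAt (fun s => e (c s)) (tangentChart e (velocity c t)).2 t := by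
  have h := (mdifferentiableAt_of_mem_maximalAtlas he ht).hasMFDerivAt.comp t hc.hasMFDerivAt
  have h' : HasFDerivAt (𝕜 := ℝ) (E := ℝ) (F := F) (fun s => e (c s)) _ t := h.hasFDerivAt
  exact h'.hasDerivAt

theorem tangentChartSymm_tangentChart (he : e ∈ IsManifold.maximalAtlas 𝓘(ℝ, F) ∞ M)
    {p : TangentBundle 𝓘(ℝ, F) M} (hp : p.1 ∈ e.source) :
    tangentChartSymm e (tangentChart e p).1 (tangentChart e p).2 = p := by
  obtain ⟨x, v⟩ := p
  have h := (mdifferentiable_of_mem_maximalAtlas he).symm_comp_deriv hp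
  have h' := congrArg (fun L : F →L[ℝ] F => L v) h
  have hx : e.symm (e x) = x := e.left_inv hp
  -- The two fibres are tangent spaces at points that are only propositionally equal. Both unfold to
  -- `F`, so the vectors are compared there.
  have key : ∀ (z : M) (a : F), z = x → a = v →
      (⟨z, a⟩ : TangentBundle 𝓘(ℝ, F) M) = ⟨x, v⟩ := by
    rintro z a rfl rfl
    rfl
  exact key _ _ hx h'

theorem tangentChart_tangentChartSymm (he : e ∈ IsManifold.maximalAtlas 𝓘(ℝ, F) ∞ M)
    {x : F} (hx : x ∈ e.target) (y : F) :
    tangentChart e (tangentChartSymm e x y) = (x, y) := by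
  have h := (mdifferentiable_of_mem_maximalAtlas he).comp_symm_deriv hx
  have h' := congrArg (fun L : F →L[ℝ] F => L y) h
  exact Prod.ext (e.right_inv hx) h'

theorem tangentChart_snd_eq_zero_iff (he : e ∈ IsManifold.maximalAtlas 𝓘(ℝ, F) ∞ M)
    {p : TangentBundle 𝓘(ℝ, F) M} (hp : p.1 ∈ e.source) :
    (tangentChart e p).2 = 0 ↔ p.2 = 0 := by
  constructor
  · intro h
    obtain ⟨x, v⟩ := p
    have h1 := (mdifferentiable_of_mem_maximalAtlas he).symm_comp_deriv hp
    have h' := congrArg (fun L : F →L[ℝ] F => L v) h1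
    refine h'.symm.trans ?_
    change mfderiv 𝓘(ℝ, F) 𝓘(ℝ, F) e.symm (e x) (tangentChart e ⟨x, v⟩).2 = 0
    rw [h]
    exact ContinuousLinearMap.map_zero _
  · intro h
    change mfderiv 𝓘(ℝ, F) 𝓘(ℝ, F) e p.1 p.2 = 0
    rw [h]
    exact ContinuousLinearMap.map_zero _

variable [IsManifold 𝓘(ℝ, F) ∞ M]

theorem contMDiffOn_tangentChart (he : e ∈ IsManifold.maximalAtlas 𝓘(ℝ, F) ∞ M) :
    ContMDiffOn 𝓘(ℝ, F).tangent 𝓘(ℝ, F × F) ∞ (tangentChart e)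
      (Bundle.TotalSpace.proj ⁻¹' e.source) := by
  have h1 : ContMDiffOn 𝓘(ℝ, F) 𝓘(ℝ, F) ∞ e e.source := contMDiffOn_of_mem_maximalAtlas he
  have h2 := h1.contMDiffOn_tangentMapWithin (m := ∞) le_rfl e.open_source.uniqueMDiffOn
  refine ContMDiffOn.prodMk_space ?_ ?_
  · exact h1.comp (Bundle.contMDiff_proj _).contMDiffOn (fun p hp => hp)
  · refine ((contMDiff_snd_tangentBundle_modelSpace F 𝓘(ℝ, F)).comp_contMDiffOn h2).congr ?_
    intro p hp
    change _ = mfderivWithin 𝓘(ℝ, F) 𝓘(ℝ, F) e e.source p.1 p.2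
    rw [mfderivWithin_of_isOpen e.open_source hp]

theorem contMDiff_tangentBundle_modelSpace_mk :
    ContMDiff 𝓘(ℝ, F × F) 𝓘(ℝ, F).tangent ∞
      (fun q : F × F => (⟨q.1, q.2⟩ : TangentBundle 𝓘(ℝ, F) F)) := by
  intro q
  refine Bundle.contMDiffAt_totalSpace.2 ⟨contDiff_fst.contMDiff.contMDiffAt, ?_⟩
  have : ContMDiff 𝓘(ℝ, F × F) 𝓘(ℝ, F) ∞ (fun q : F × F => q.2) := contDiff_snd.contMDiff
  convert! this.contMDiffAt (x := q) using 1
  ext x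
  simp

theorem contMDiffOn_tangentChartSymm (he : e ∈ IsManifold.maximalAtlas 𝓘(ℝ, F) ∞ M) :
    ContMDiffOn 𝓘(ℝ, F × F) 𝓘(ℝ, F).tangent ∞
      (fun q : F × F => tangentChartSymm e q.1 q.2) (Prod.fst ⁻¹' e.target) := by
  have h1 : ContMDiffOn 𝓘(ℝ, F) 𝓘(ℝ, F) ∞ e.symm e.target :=
    contMDiffOn_symm_of_mem_maximalAtlas he
  have h2 := h1.contMDiffOn_tangentMapWithin (m := ∞) le_rfl e.open_target.uniqueMDiffOn
  refine (h2.comp (contMDiff_tangentBundle_modelSpace_mk (F := F)).contMDiffOn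
    (fun q hq => hq)).congr ?_
  intro q hq
  change _ = (⟨e.symm q.1, mfderivWithin 𝓘(ℝ, F) 𝓘(ℝ, F) e.symm e.target q.1 q.2⟩ :
    TangentBundle 𝓘(ℝ, F) M)
  rw [mfderivWithin_of_isOpen e.open_target hq]
  rfl

theorem isOpen_proj_preimage {s : Set M} (hs : IsOpen s) :
    IsOpen (Bundle.TotalSpace.proj ⁻¹' s : Set (TangentBundle 𝓘(ℝ, F) M)) :=
  hs.preimage (FiberBundle.continuous_proj F (TangentSpace 𝓘(ℝ, F) : M → Type _))

theorem mdifferentiableAt_tangentChart (he : e ∈ IsManifold.maximalAtlas 𝓘(ℝ, F) ∞ M)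
    {p : TangentBundle 𝓘(ℝ, F) M} (hp : p.1 ∈ e.source) :
    MDifferentiableAt 𝓘(ℝ, F).tangent 𝓘(ℝ, F × F) (tangentChart e) p :=
  ((contMDiffOn_tangentChart he).contMDiffAt
    ((isOpen_proj_preimage e.open_source).mem_nhds hp)).mdifferentiableAt (by simp)

/-- The tangent chart has a differentiable local left inverse, `tangentChartSymm`, so its
differential is injective. This allows an equation between vectors tangent to `TM` to be checked on
components. -/
theorem components_injective (he : e ∈ IsManifold.maximalAtlas 𝓘(ℝ, F) ∞ M)
    {p : TangentBundle 𝓘(ℝ, F) M} (hp : p.1 ∈ e.source) :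
    Function.Injective (components e p) := by
  have hq : (tangentChart e p).1 ∈ e.target := e.map_source hp
  have h1 : MDifferentiableAt 𝓘(ℝ, F × F) 𝓘(ℝ, F).tangent
      (fun q : F × F => tangentChartSymm e q.1 q.2) (tangentChart e p) :=
    ((contMDiffOn_tangentChartSymm he).contMDiffAt
      ((e.open_target.preimage continuous_fst).mem_nhds hq)).mdifferentiableAt (by simp)
  have h2 := h1.hasMFDerivAt.comp p (mdifferentiableAt_tangentChart he hp).hasMFDerivAt
  have h3 : HasMFDerivAt 𝓘(ℝ, F).tangent 𝓘(ℝ, F).tangent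
      ((fun q : F × F => tangentChartSymm e q.1 q.2) ∘ tangentChart e) p
      (ContinuousLinearMap.id ℝ (TangentSpace 𝓘(ℝ, F).tangent p)) := by
    refine (hasMFDerivAt_id p).congr_of_eventuallyEq ?_
    filter_upwards [(isOpen_proj_preimage e.open_source).mem_nhds hp] with q hq
    exact tangentChartSymm_tangentChart he hq
  have h4 := hasMFDerivAt_unique h2 h3
  intro a b hab
  have ha := congrArg (fun L : (F × F) →L[ℝ] (F × F) => L a) h4
  have hb := congrArg (fun L : (F × F) →L[ℝ] (F × F) => L b) h4
  refine ha.symm.trans (Eq.trans ?_ hb)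
  change (mfderiv 𝓘(ℝ, F × F) 𝓘(ℝ, F).tangent
      (fun q : F × F => tangentChartSymm e q.1 q.2) (tangentChart e p)) (components e p a) =
    (mfderiv 𝓘(ℝ, F × F) 𝓘(ℝ, F).tangent
      (fun q : F × F => tangentChartSymm e q.1 q.2) (tangentChart e p)) (components e p b)
  rw [hab]

/-- The coefficient is a composite of the inverse tangent chart, the spray and the differential of
the tangent chart. The origin is removed because the spray is smooth only off the zero section. -/
theorem contDiffOn_coefficient (S : Spray F M) (he : e ∈ IsManifold.maximalAtlas 𝓘(ℝ, F) ∞ M)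
    {x : F} (hx : x ∈ e.target) : ContDiffOn ℝ ∞ (coefficient S.toFun e x) {0}ᶜ := by
  have hT := (contMDiffOn_tangentChart he).contMDiffOn_tangentMapWithin (m := ∞) le_rfl
    (isOpen_proj_preimage e.open_source).uniqueMDiffOn
  have hs := (contMDiff_snd_tangentBundle_modelSpace (F × F) 𝓘(ℝ, F × F) (n := ∞)).comp_contMDiffOn hT
  have hσ : ContMDiffOn 𝓘(ℝ, F) 𝓘(ℝ, F).tangent ∞ (fun y => tangentChartSymm e x y) {0}ᶜ :=
    (contMDiffOn_tangentChartSymm he).comp (t := Prod.fst ⁻¹' e.target)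
      (f := fun y : F => (x, y)) (contDiff_const.prodMk contDiff_id).contMDiff.contMDiffOn
      (fun y _ => hx)
  have hmem : ∀ y ∈ ({0}ᶜ : Set F), tangentChartSymm e x y ∈ slit F M := by
    intro y hy h0
    have h1 := (tangentChart_snd_eq_zero_iff he (p := tangentChartSymm e x y)
      (e.map_target hx)).2 h0
    rw [tangentChart_tangentChartSymm he hx] at h1
    exact hy h1
  have hS := S.smooth.comp hσ hmem
  have h := hs.comp hS (fun y _ => e.map_target hx)
  have h' : ContDiffOn ℝ ∞ _ _ := h.contDiffOn
  refine (contDiffOn_const (c := (-(1 / 2 : ℝ)))).smul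
    ((contDiff_snd.comp_contDiffOn h').congr ?_)
  intro y hy
  change _ = (mfderivWithin 𝓘(ℝ, F).tangent 𝓘(ℝ, F × F) (tangentChart e)
    (Bundle.TotalSpace.proj ⁻¹' e.source) (tangentChartSymm e x y)
      (S.toFun (tangentChartSymm e x y))).2
  rw [mfderivWithin_of_isOpen (isOpen_proj_preimage e.open_source) (e.map_target hx)]
  rfl

theorem hasDerivAt_tangentChart_comp (he : e ∈ IsManifold.maximalAtlas 𝓘(ℝ, F) ∞ M)
    {Z : ℝ → TangentBundle 𝓘(ℝ, F) M} {t : ℝ} {L : ℝ →L[ℝ] TangentSpace 𝓘(ℝ, F).tangent (Z t)}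
    (hZ : HasMFDerivAt 𝓘(ℝ, ℝ) 𝓘(ℝ, F).tangent Z t L) (ht : (Z t).1 ∈ e.source) :
    HasDerivAt (fun s => tangentChart e (Z s)) (components e (Z t) (L 1)) t := by
  have h' : HasFDerivAt (𝕜 := ℝ) (E := ℝ) (F := F × F) (fun s => tangentChart e (Z s)) _ t :=
    ((mdifferentiableAt_tangentChart he ht).hasMFDerivAt.comp t hZ).hasFDerivAt
  exact h'.hasDerivAt

theorem coefficient_tangentChart (S : Spray F M)
    (he : e ∈ IsManifold.maximalAtlas 𝓘(ℝ, F) ∞ M) {p : TangentBundle 𝓘(ℝ, F) M}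
    (hp : p.1 ∈ e.source) :
    (components e p (S.toFun p)).2 =
      (-2 : ℝ) • coefficient S.toFun e (e p.1) (tangentChart e p).2 := by
  have h : coefficient S.toFun e (e p.1) (tangentChart e p).2 =
      -(1 / 2 : ℝ) • (components e p (S.toFun p)).2 := by
    have := tangentChartSymm_tangentChart he hp
    change tangentChartSymm e (e p.1) (tangentChart e p).2 = p at this
    unfold coefficient
    rw [this]
  rw [h, smul_smul]
  norm_num

theorem contMDiffOn_velocity {c : ℝ → M} {J : Set ℝ} (hJ : IsOpen J)
    (hc : ContMDiffOn 𝓘(ℝ, ℝ) 𝓘(ℝ, F) ∞ c J) :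
    ContMDiffOn 𝓘(ℝ, ℝ) 𝓘(ℝ, F).tangent ∞ (velocity (F := F) c) J := by
  have h2 := hc.contMDiffOn_tangentMapWithin (m := ∞) le_rfl hJ.uniqueMDiffOn
  have h3 : ContMDiff 𝓘(ℝ, ℝ) 𝓘(ℝ, ℝ).tangent ∞
      (fun t : ℝ => (⟨t, (1 : ℝ)⟩ : TangentBundle 𝓘(ℝ, ℝ) ℝ)) :=
    contMDiff_tangentBundle_modelSpace_mk.comp
      (contDiff_id.prodMk (contDiff_const (c := (1 : ℝ)))).contMDiff
  refine (h2.comp h3.contMDiffOn (fun t ht => ht)).congr ?_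
  intro t ht
  change _ = (⟨c t, mfderivWithin 𝓘(ℝ, ℝ) 𝓘(ℝ, F) c J t (1 : ℝ)⟩ : TangentBundle 𝓘(ℝ, F) M)
  rw [mfderivWithin_of_isOpen hJ ht]
  rfl

/-- A curve satisfies the geodesic equation of `S` at time `t` if and only if it satisfies the
second order equation `x'' = -2 𝐆(x, x')` in a chart. -/
theorem hasMFDerivAt_velocity_iff (S : Spray F M)
    (he : e ∈ IsManifold.maximalAtlas 𝓘(ℝ, F) ∞ M) {c : ℝ → M} {J : Set ℝ} (hJ : IsOpen J)
    (hc : ContMDiffOn 𝓘(ℝ, ℝ) 𝓘(ℝ, F) ∞ c J) {t : ℝ} (ht : t ∈ J)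
    (hv : velocity c t ∈ slit F M) (hte : c t ∈ e.source) :
    HasMFDerivAt 𝓘(ℝ, ℝ) 𝓘(ℝ, F).tangent (velocity (F := F) c) t
        ((1 : ℝ →L[ℝ] ℝ).smulRight (S.toFun (velocity c t))) ↔
      HasDerivAt (fun s => (tangentChart e (velocity c s)).2)
        ((-2 : ℝ) • coefficient S.toFun e (e (c t)) (tangentChart e (velocity c t)).2) t := by
  have hco := coefficient_tangentChart S he (p := velocity c t) hte
  have hfst := S.fst_components e he _ hv hte
  have hone : ((1 : ℝ →L[ℝ] ℝ).smulRight (S.toFun (velocity c t)) :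
      ℝ →L[ℝ] TangentSpace 𝓘(ℝ, F).tangent (velocity c t)) 1 = S.toFun (velocity c t) := by
    simp
  constructor
  · intro h
    have h1 := hasDerivAt_tangentChart_comp he h hte
    rw [hone] at h1
    have h2 := (hasFDerivAt_snd (p := tangentChart e (velocity c t))).comp_hasDerivAt t h1
    exact hco ▸ h2
  · intro h
    have hd : MDifferentiableAt 𝓘(ℝ, ℝ) 𝓘(ℝ, F).tangent (velocity (F := F) c) t :=
      ((contMDiffOn_velocity hJ hc).contMDiffAt (hJ.mem_nhds ht)).mdifferentiableAt (by simp)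
    have hd' := hd.hasMFDerivAt
    have h1 := hasDerivAt_tangentChart_comp he hd' hte
    have hfst' : HasDerivAt (fun s => (tangentChart e (velocity c s)).1) _ t :=
      (hasFDerivAt_fst (p := tangentChart e (velocity c t))).comp_hasDerivAt t h1
    have hsnd' : HasDerivAt (fun s => (tangentChart e (velocity c s)).2) _ t :=
      (hasFDerivAt_snd (p := tangentChart e (velocity c t))).comp_hasDerivAt t h1
    have hcd : MDifferentiableAt 𝓘(ℝ, ℝ) 𝓘(ℝ, F) c t :=
      (hc.contMDiffAt (hJ.mem_nhds ht)).mdifferentiableAt (by simp)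
    -- The `∂_x` components agree for every curve, both being the velocity in the chart. Only the
    -- `∂_y` components carry the equation.
    have e1 := hfst'.unique (mfderiv_chart_comp he hcd hte)
    have e2 := hsnd'.unique h
    have e3 := components_injective he (p := velocity c t) hte
      (a₁ := mfderiv 𝓘(ℝ, ℝ) 𝓘(ℝ, F).tangent (velocity (F := F) c) t (1 : ℝ))
      (a₂ := S.toFun (velocity c t)) (Prod.ext (e1.trans hfst.symm) (e2.trans hco.symm))
    have e5 : mfderiv 𝓘(ℝ, ℝ) 𝓘(ℝ, F).tangent (velocity (F := F) c) t =
        (1 : ℝ →L[ℝ] ℝ).smulRight (S.toFun (velocity c t)) :=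
      eq_smulRight_one_of_apply_one (V := F × F)
        (L := mfderiv 𝓘(ℝ, ℝ) 𝓘(ℝ, F).tangent (velocity (F := F) c) t) e3
    exact e5 ▸ hd'

end TangentChart

end

end HomogeneousSpray

namespace HomogeneousSpray

noncomputable section

/-! ### Derivatives along left invariant vector fields -/

section LeftDeriv

variable {E : Type*} [NormedAddCommGroup E] [NormedSpace ℝ E]
  {F : Type*} [NormedAddCommGroup F] [NormedSpace ℝ F]
  {G : Type*} [TopologicalSpace G] [ChartedSpace E G] [Group G]

/-- The derivatives `v ↦ X_v f (g)` of a function on a Lie group along the left invariant vector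
fields `X_v`. -/
def leftDeriv (f : G → F) (g : G) : E →L[ℝ] F :=
  mfderiv 𝓘(ℝ, E) 𝓘(ℝ, F) (fun h => f (g * h)) 1

variable [LieGroup 𝓘(ℝ, E) ∞ G]

theorem mdifferentiableAt_mul_left (g h : G) :
    MDifferentiableAt 𝓘(ℝ, E) 𝓘(ℝ, E) (fun x => g * x) h :=
  (contMDiff_mul_left (n := ∞)).mdifferentiableAt (by simp)

theorem leftDeriv_apply {f : G → F} {g : G} (hf : MDifferentiableAt 𝓘(ℝ, E) 𝓘(ℝ, F) f g)
    (v : E) :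
    leftDeriv f g v = mfderiv 𝓘(ℝ, E) 𝓘(ℝ, F) f g (mulInvariantVectorField (I := 𝓘(ℝ, E)) v g) := by
  have h1 : ∀ g', g' = g → HasMFDerivAt 𝓘(ℝ, E) 𝓘(ℝ, F) f g'
      (mfderiv 𝓘(ℝ, E) 𝓘(ℝ, F) f g : E →L[ℝ] F) := by
    rintro _ rfl
    exact hf.hasMFDerivAt
  have h2 := ((h1 (g * 1) (mul_one g)).comp (1 : G)
    (mdifferentiableAt_mul_left g 1).hasMFDerivAt).mfderiv
  exact congrArg (fun L : E →L[ℝ] F => L v) h2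

/-- This is the partial derivative at `h = 1` of the smooth map `(g, h) ↦ f (g * h)`, with `g` as
parameter. The base point `1` does not move, so the trivialization of the tangent bundle enters as
the identity. -/
theorem contMDiffOn_leftDeriv {f : G → F} {U : Set G} (hU : IsOpen U)
    (hf : ContMDiffOn 𝓘(ℝ, E) 𝓘(ℝ, F) ∞ f U) :
    ContMDiffOn 𝓘(ℝ, E) 𝓘(ℝ, E →L[ℝ] F) ∞ (leftDeriv f : G → E →L[ℝ] F) U := by
  intro g hg
  refine ContMDiffAt.contMDiffWithinAt ?_
  have h1 : ContMDiffAt (𝓘(ℝ, E).prod 𝓘(ℝ, E)) 𝓘(ℝ, F) ∞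
      (Function.uncurry fun g h : G => f (g * h)) (g, (fun _ : G => (1 : G)) g) := by
    refine ContMDiffAt.comp (I' := 𝓘(ℝ, E)) (g := f) (f := fun p : G × G => p.1 * p.2) _ ?_
      (contMDiff_mul 𝓘(ℝ, E) ∞).contMDiffAt
    simp only [mul_one]
    exact hf.contMDiffAt (hU.mem_nhds hg)
  have h2 := ContMDiffAt.mfderiv (fun g h : G => f (g * h)) (fun _ : G => (1 : G)) h1
    contMDiffAt_const (m := ∞) le_rfl
  convert! h2 using 1
  ext x v
  have h3 : (trivializationAt E (TangentSpace 𝓘(ℝ, E)) (1 : G)).symmL ℝ (1 : G) v = v := by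
    rw [TangentBundle.symmL_trivializationAt_eq_core (mem_chart_source E (1 : G))]
    exact (tangentBundleCore 𝓘(ℝ, E) G).coordChange_self (achart E 1) 1
      (mem_chart_source E (1 : G)) v
  change _ = (trivializationAt F (TangentSpace 𝓘(ℝ, F)) (f (g * 1))).continuousLinearMapAt ℝ
    (f (x * 1)) ((leftDeriv f x : E →L[ℝ] F)
      ((trivializationAt E (TangentSpace 𝓘(ℝ, E)) (1 : G)).symmL ℝ (1 : G) v))
  rw [TangentBundle.continuousLinearMapAt_model_space]
  exact (congrArg (leftDeriv f x : E →L[ℝ] F) h3).symm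

theorem mulInvariantVectorField_leftVelocity (γ : ℝ → G) (t : ℝ) :
    (mulInvariantVectorField (leftVelocity γ t) (γ t) : E) =
      mfderiv 𝓘(ℝ, ℝ) 𝓘(ℝ, E) γ t (1 : ℝ) := by
  -- The point `(γ t)⁻¹ * γ t` is `1` only propositionally. Quantifying over `x = 1` moves the
  -- derivative there without rewriting in dependent types.
  have h1 : ∀ x, x = (1 : G) → HasMFDerivAt 𝓘(ℝ, E) 𝓘(ℝ, E) (fun x => γ t * x) x
      (mfderiv 𝓘(ℝ, E) 𝓘(ℝ, E) (fun x => γ t * x) (1 : G) : E →L[ℝ] E) := by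
    rintro _ rfl
    exact (mdifferentiableAt_mul_left _ _).hasMFDerivAt
  have h2 := (h1 ((γ t)⁻¹ * γ t) (inv_mul_cancel _)).comp (γ t)
    (mdifferentiableAt_mul_left (γ t)⁻¹ (γ t)).hasMFDerivAt
  have h3 : HasMFDerivAt 𝓘(ℝ, E) 𝓘(ℝ, E) ((fun x => γ t * x) ∘ (fun x => (γ t)⁻¹ * x)) (γ t)
      (ContinuousLinearMap.id ℝ E) :=
    (hasMFDerivAt_id (γ t)).congr_of_eventuallyEq
      (Filter.Eventually.of_forall fun x => by simp)
  exact congrArg (fun L : E →L[ℝ] E => L (mfderiv 𝓘(ℝ, ℝ) 𝓘(ℝ, E) γ t (1 : ℝ)))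
    (hasMFDerivAt_unique h2 h3)

theorem leftVelocity_eq_of_mfderiv_eq {γ : ℝ → G} {t : ℝ} {v : E}
    (h : (mfderiv 𝓘(ℝ, ℝ) 𝓘(ℝ, E) γ t (1 : ℝ) : E) =
      mulInvariantVectorField (I := 𝓘(ℝ, E)) v (γ t)) :
    (leftVelocity γ t : E) = v := by
  have h1 : ∀ x, x = γ t → HasMFDerivAt 𝓘(ℝ, E) 𝓘(ℝ, E) (fun x => (γ t)⁻¹ * x) x
      (mfderiv 𝓘(ℝ, E) 𝓘(ℝ, E) (fun x => (γ t)⁻¹ * x) (γ t) : E →L[ℝ] E) := by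
    rintro _ rfl
    exact (mdifferentiableAt_mul_left _ _).hasMFDerivAt
  have h2 := (h1 (γ t * 1) (mul_one _)).comp (1 : G)
    (mdifferentiableAt_mul_left (γ t) 1).hasMFDerivAt
  have h3 : HasMFDerivAt 𝓘(ℝ, E) 𝓘(ℝ, E) ((fun x => (γ t)⁻¹ * x) ∘ (fun x => γ t * x)) (1 : G)
      (ContinuousLinearMap.id ℝ E) :=
    (hasMFDerivAt_id (1 : G)).congr_of_eventuallyEq
      (Filter.Eventually.of_forall fun x => by simp)
  have h4 := congrArg (fun L : E →L[ℝ] E => L v) (hasMFDerivAt_unique h2 h3)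
  have h5 : (leftVelocity γ t : E) = (mfderiv 𝓘(ℝ, E) 𝓘(ℝ, E) (fun x => (γ t)⁻¹ * x) (γ t) :
      E →L[ℝ] E) (mulInvariantVectorField (I := 𝓘(ℝ, E)) v (γ t)) := by
    rw [← h]
    rfl
  exact h5.trans h4

theorem hasDerivAt_comp_leftDeriv {f : G → F} {γ : ℝ → G} {t : ℝ}
    (hγ : MDifferentiableAt 𝓘(ℝ, ℝ) 𝓘(ℝ, E) γ t)
    (hf : MDifferentiableAt 𝓘(ℝ, E) 𝓘(ℝ, F) f (γ t)) :
    HasDerivAt (fun s => f (γ s)) ((leftDeriv f (γ t) : E →L[ℝ] F) (leftVelocity γ t)) t := by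
  have h' : HasFDerivAt (𝕜 := ℝ) (E := ℝ) (F := F) (fun s => f (γ s)) _ t :=
    (hf.hasMFDerivAt.comp t hγ.hasMFDerivAt).hasFDerivAt
  have h1 := h'.hasDerivAt
  have h2 := congrArg (mfderiv 𝓘(ℝ, E) 𝓘(ℝ, F) f (γ t) : E →L[ℝ] F)
    (mulInvariantVectorField_leftVelocity γ t)
  exact ((leftDeriv_apply hf _).trans h2) ▸ h1

theorem leftVelocity_mul_left (g : G) {γ : ℝ → G} {t : ℝ}
    (hγ : MDifferentiableAt 𝓘(ℝ, ℝ) 𝓘(ℝ, E) γ t) :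
    (leftVelocity (fun s => g * γ s) t : E) = (leftVelocity γ t : E) := by
  have h1 : HasMFDerivAt 𝓘(ℝ, ℝ) 𝓘(ℝ, E) (fun s => g * γ s) t _ :=
    (mdifferentiableAt_mul_left g (γ t)).hasMFDerivAt.comp t hγ.hasMFDerivAt
  have h2 := (mdifferentiableAt_mul_left (g * γ t)⁻¹ (g * γ t)).hasMFDerivAt.comp t h1
  have h3 := (mdifferentiableAt_mul_left (γ t)⁻¹ (γ t)).hasMFDerivAt.comp t hγ.hasMFDerivAt
  have h4 : (fun x => (g * γ t)⁻¹ * x) ∘ (fun s => g * γ s) = (fun x => (γ t)⁻¹ * x) ∘ γ := by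
    ext s
    simp only [Function.comp]
    group
  rw [h4] at h2
  have h5 := congrArg (fun L : ℝ →L[ℝ] E => L 1) (hasMFDerivAt_unique h2 h3)
  have h6 := congrArg (fun L : ℝ →L[ℝ] E => L 1) h1.mfderiv
  refine Eq.trans ?_ h5
  exact congrArg (mfderiv 𝓘(ℝ, E) 𝓘(ℝ, E) (fun x => (g * γ t)⁻¹ * x) (g * γ t) : E →L[ℝ] E) h6

/-- The second derivatives of `f` along left invariant vector fields, as a bilinear map. -/
theorem leftDeriv_leftDeriv_apply {f : G → F} {U : Set G} (hU : IsOpen U)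
    (hf : ContMDiffOn 𝓘(ℝ, E) 𝓘(ℝ, F) ∞ f U) {g : G} (hg : g ∈ U) (u v : E) :
    leftDeriv (fun x => (leftDeriv f x : E →L[ℝ] F) u) g v =
      (leftDeriv (leftDeriv f : G → E →L[ℝ] F) g : E →L[ℝ] E →L[ℝ] F) v u := by
  have h1 : MDifferentiableAt 𝓘(ℝ, E) 𝓘(ℝ, E →L[ℝ] F) (leftDeriv f : G → E →L[ℝ] F) g :=
    ((contMDiffOn_leftDeriv hU hf).contMDiffAt (hU.mem_nhds hg)).mdifferentiableAt (by simp)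
  have h2 := ((ContinuousLinearMap.apply ℝ F u).hasFDerivAt
    (x := leftDeriv f g)).hasMFDerivAt.comp g h1.hasMFDerivAt
  refine (leftDeriv_apply h2.mdifferentiableAt v).trans ?_
  refine Eq.trans ?_ (congrArg (fun L : E →L[ℝ] F => L u) (leftDeriv_apply h1 v)).symm
  exact congrArg (fun L : E →L[ℝ] F => L (mulInvariantVectorField (I := 𝓘(ℝ, E)) v g)) h2.mfderiv

/-- Product rule for a moving operator applied to a moving vector. With `w` the left velocity it
computes the acceleration of a projected curve; with `w = y` it computes the derivative of a field
along it. -/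
theorem hasDerivAt_leftDeriv_apply {f : G → F} {U : Set G} (hU : IsOpen U)
    (hf : ContMDiffOn 𝓘(ℝ, E) 𝓘(ℝ, F) ∞ f U) {γ : ℝ → G} {t : ℝ}
    (hγ : MDifferentiableAt 𝓘(ℝ, ℝ) 𝓘(ℝ, E) γ t) (ht : γ t ∈ U) {w : ℝ → E} {w' : E}
    (hw : HasDerivAt w w' t) :
    HasDerivAt (fun s => (leftDeriv f (γ s) : E →L[ℝ] F) (w s))
      ((leftDeriv (leftDeriv f : G → E →L[ℝ] F) (γ t) : E →L[ℝ] E →L[ℝ] F) (leftVelocity γ t)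
        (w t) + (leftDeriv f (γ t) : E →L[ℝ] F) w') t := by
  have h1 : MDifferentiableAt 𝓘(ℝ, E) 𝓘(ℝ, E →L[ℝ] F) (leftDeriv f : G → E →L[ℝ] F) (γ t) :=
    ((contMDiffOn_leftDeriv hU hf).contMDiffAt (hU.mem_nhds ht)).mdifferentiableAt (by simp)
  exact (hasDerivAt_comp_leftDeriv hγ h1).clm_apply hw

theorem two_le_infty : (2 : WithTop ℕ∞) ≤ ∞ := WithTop.coe_le_coe.2 le_top

theorem one_add_one_le_infty : (1 + 1 : WithTop ℕ∞) ≤ ∞ := WithTop.coe_le_coe.2 le_top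

/-- Each iterated derivative is a second derivative of `φ` plus a derivative of the inner field. The
second derivative is symmetric and cancels, leaving the bracket. -/
theorem fderiv_fderiv_apply_sub {φ : E → F} {a : E} (hφ : ContDiffAt ℝ ∞ φ a) {V W : E → E}
    (hV : DifferentiableAt ℝ V a) (hW : DifferentiableAt ℝ W a) :
    fderiv ℝ (fun x => fderiv ℝ φ x (W x)) a (V a) - fderiv ℝ (fun x => fderiv ℝ φ x (V x)) a (W a)
      = fderiv ℝ φ a (VectorField.lieBracket ℝ V W a) := by
  have h1 : DifferentiableAt ℝ (fderiv ℝ φ) a :=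
    (hφ.fderiv_right (m := 1) one_add_one_le_infty).differentiableAt (by simp)
  have h2 : IsSymmSndFDerivAt ℝ φ a :=
    hφ.isSymmSndFDerivAt (by simpa using two_le_infty)
  have h3 : ∀ X : E → E, DifferentiableAt ℝ X a → ∀ u, fderiv ℝ (fun x => fderiv ℝ φ x (X x)) a u =
      fderiv ℝ φ a (fderiv ℝ X a u) + fderiv ℝ (fderiv ℝ φ) a u (X a) := by
    intro X hX u
    rw [fderiv_clm_apply h1 hX]
    simp
  rw [h3 W hW, h3 V hV, h2.eq (V a) (W a), VectorField.lieBracket, map_sub]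
  abel

/-! ### The Lie bracket as a commutator of derivations -/

section VectorField

variable {M : Type*} [TopologicalSpace M] [ChartedSpace E M]

/-- The derivative of a function along a vector field. -/
def alongDeriv (X : (x : M) → TangentSpace 𝓘(ℝ, E) x) (f : M → F) (x : M) : F :=
  mfderiv 𝓘(ℝ, E) 𝓘(ℝ, F) f x (X x)

/-- The expression of a vector field in a chart. -/
def chartField (e : OpenPartialHomeomorph M E) (X : (x : M) → TangentSpace 𝓘(ℝ, E) x) (a : E) :
    E :=
  mfderiv 𝓘(ℝ, E) 𝓘(ℝ, E) e (e.symm a) (X (e.symm a))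

theorem chartField_apply {e : OpenPartialHomeomorph M E}
    (X : (x : M) → TangentSpace 𝓘(ℝ, E) x) {x : M} (hx : x ∈ e.source) :
    chartField e X (e x) = mfderiv 𝓘(ℝ, E) 𝓘(ℝ, E) e x (X x) := by
  have : ∀ z, z = x → (mfderiv 𝓘(ℝ, E) 𝓘(ℝ, E) e z (X z) : E) =
      mfderiv 𝓘(ℝ, E) 𝓘(ℝ, E) e x (X x) := by
    rintro _ rfl
    rfl
  exact this _ (e.left_inv hx)

theorem mfderiv_eq_fderiv_comp {e : OpenPartialHomeomorph M E}
    (he : e ∈ IsManifold.maximalAtlas 𝓘(ℝ, E) ∞ M) {f : M → F} {x : M} (hx : x ∈ e.source)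
    (hf : DifferentiableAt ℝ (fun a => f (e.symm a)) (e x)) :
    HasMFDerivAt 𝓘(ℝ, E) 𝓘(ℝ, F) f x
      ((fderiv ℝ (fun a => f (e.symm a)) (e x)).comp
        (mfderiv 𝓘(ℝ, E) 𝓘(ℝ, E) e x : E →L[ℝ] E)) := by
  have h := (hf.hasFDerivAt.hasMFDerivAt).comp x
    (mdifferentiableAt_of_mem_maximalAtlas he hx).hasMFDerivAt
  refine h.congr_of_eventuallyEq ?_
  filter_upwards [e.open_source.mem_nhds hx] with z hz
  simp [e.left_inv hz]

theorem alongDeriv_eq_fderiv {e : OpenPartialHomeomorph M E}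
    (he : e ∈ IsManifold.maximalAtlas 𝓘(ℝ, E) ∞ M) {f : M → F} {x : M} (hx : x ∈ e.source)
    (hf : DifferentiableAt ℝ (fun a => f (e.symm a)) (e x))
    (X : (x : M) → TangentSpace 𝓘(ℝ, E) x) :
    alongDeriv X f x = fderiv ℝ (fun a => f (e.symm a)) (e x) (chartField e X (e x)) := by
  rw [chartField_apply X hx]
  exact congrArg (fun L : E →L[ℝ] F => L (X x)) (mfderiv_eq_fderiv_comp he hx hf).mfderiv

theorem mpullbackWithin_extChartAt_symm [IsManifold 𝓘(ℝ, E) ∞ M] (g : M)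
    (X : (x : M) → TangentSpace 𝓘(ℝ, E) x) {a : E} (ha : a ∈ (chartAt E g).target) :
    VectorField.mpullbackWithin 𝓘(ℝ, E) 𝓘(ℝ, E) (extChartAt 𝓘(ℝ, E) g).symm X
        (range 𝓘(ℝ, E)) a = chartField (chartAt E g) X a := by
  have hM := mdifferentiable_of_mem_maximalAtlas (F := E)
    (IsManifold.chart_mem_maximalAtlas (I := 𝓘(ℝ, E)) (n := ∞) g)
  have h1 := hM.comp_symm_deriv ha
  have h2 := hM.symm_comp_deriv ((chartAt E g).map_target ha)
  rw [(chartAt E g).right_inv ha] at h2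
  have h3 : (mfderiv 𝓘(ℝ, E) 𝓘(ℝ, E) (chartAt E g).symm a : E →L[ℝ] E).inverse =
      (mfderiv 𝓘(ℝ, E) 𝓘(ℝ, E) (chartAt E g) ((chartAt E g).symm a) : E →L[ℝ] E) :=
    ContinuousLinearMap.inverse_eq h2 h1
  rw [VectorField.mpullbackWithin_apply, modelWithCornersSelf_coe, range_id, mfderivWithin_univ]
  exact congrArg (fun L : E →L[ℝ] E => L (X ((chartAt E g).symm a))) h3

/-- In the preferred chart at `g` this becomes the identity `fderiv_fderiv_apply_sub` on `E`,
because `mlieBracket` is itself defined by transporting the fields to that chart. -/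
theorem alongDeriv_mlieBracket [CompleteSpace E] [IsManifold 𝓘(ℝ, E) ∞ M] {f : M → F} {U : Set M}
    (hU : IsOpen U) (hf : ContMDiffOn 𝓘(ℝ, E) 𝓘(ℝ, F) ∞ f U) {g : M} (hg : g ∈ U)
    {V W : (x : M) → TangentSpace 𝓘(ℝ, E) x}
    (hV : MDifferentiableAt 𝓘(ℝ, E) 𝓘(ℝ, E).tangent
      (fun x => (V x : TangentBundle 𝓘(ℝ, E) M)) g)
    (hW : MDifferentiableAt 𝓘(ℝ, E) 𝓘(ℝ, E).tangent
      (fun x => (W x : TangentBundle 𝓘(ℝ, E) M)) g) :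
    alongDeriv V (alongDeriv W f) g - alongDeriv W (alongDeriv V f) g =
      alongDeriv (VectorField.mlieBracket 𝓘(ℝ, E) V W) f g := by
  have : IsManifold 𝓘(ℝ, E) 2 M := IsManifold.of_le (n := ∞) two_le_infty
  have he : chartAt E g ∈ IsManifold.maximalAtlas 𝓘(ℝ, E) ∞ M :=
    IsManifold.chart_mem_maximalAtlas g
  have hge : g ∈ (chartAt E g).source := mem_chart_source E g
  have hget : chartAt E g g ∈ (chartAt E g).target := mem_chart_target E g
  have hpull : ∀ X : (x : M) → TangentSpace 𝓘(ℝ, E) x,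
      VectorField.mpullbackWithin 𝓘(ℝ, E) 𝓘(ℝ, E) (extChartAt 𝓘(ℝ, E) g).symm X
        (range 𝓘(ℝ, E)) =ᶠ[𝓝 (chartAt E g g)] chartField (chartAt E g) X := by
    intro X
    filter_upwards [(chartAt E g).open_target.mem_nhds hget] with a ha
    exact mpullbackWithin_extChartAt_symm g X ha
  have hpull_diff : ∀ (X : (x : M) → TangentSpace 𝓘(ℝ, E) x),
      MDifferentiableAt 𝓘(ℝ, E) 𝓘(ℝ, E).tangent (fun x => (X x : TangentBundle 𝓘(ℝ, E) M)) g →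
      DifferentiableAt ℝ (chartField (chartAt E g) X) (chartAt E g g) := by
    intro X hX
    have h := hX.mdifferentiableWithinAt
      (s := univ).differentiableWithinAt_mpullbackWithin_vectorField
    have h' : DifferentiableAt ℝ (F := E) (VectorField.mpullbackWithin 𝓘(ℝ, E) 𝓘(ℝ, E)
        (extChartAt 𝓘(ℝ, E) g).symm X (range 𝓘(ℝ, E))) (chartAt E g g) :=
      DifferentiableWithinAt.differentiableAt (F := E) h (by simp)
    exact (Filter.EventuallyEq.differentiableAt_iff (F := E) (hpull X)).1 h'
  have hφ : ∀ x ∈ U ∩ (chartAt E g).source,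
      ContDiffAt ℝ ∞ (fun a => f ((chartAt E g).symm a)) (chartAt E g x) := by
    rintro x ⟨hxU, hxe⟩
    have h1 : ContMDiffAt 𝓘(ℝ, E) 𝓘(ℝ, F) ∞ f ((chartAt E g).symm (chartAt E g x)) := by
      rw [(chartAt E g).left_inv hxe]
      exact hf.contMDiffAt (hU.mem_nhds hxU)
    have h2 : ContMDiffAt 𝓘(ℝ, E) 𝓘(ℝ, E) ∞ (chartAt E g).symm (chartAt E g x) :=
      (contMDiffOn_symm_of_mem_maximalAtlas he).contMDiffAt
        ((chartAt E g).open_target.mem_nhds ((chartAt E g).map_source hxe))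
    exact (h1.comp _ h2).contDiffAt
  have hder : ∀ X Z : (x : M) → TangentSpace 𝓘(ℝ, E) x,
      MDifferentiableAt 𝓘(ℝ, E) 𝓘(ℝ, E).tangent (fun x => (X x : TangentBundle 𝓘(ℝ, E) M)) g →
      alongDeriv Z (alongDeriv X f) g =
        fderiv ℝ (fun a => fderiv ℝ (fun a => f ((chartAt E g).symm a)) a
          (chartField (chartAt E g) X a)) (chartAt E g g)
            (chartField (chartAt E g) Z (chartAt E g g)) := by
    intro X Z hX
    have h1 : DifferentiableAt ℝ (fun a => fderiv ℝ (fun a => f ((chartAt E g).symm a)) a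
          (chartField (chartAt E g) X a)) (chartAt E g g) :=
      (((hφ g ⟨hg, hge⟩).fderiv_right (m := 1) one_add_one_le_infty).differentiableAt
        (by simp)).clm_apply (hpull_diff X hX)
    have h2 : (fun a => alongDeriv X f ((chartAt E g).symm a)) =ᶠ[𝓝 (chartAt E g g)]
        (fun a => fderiv ℝ (fun a => f ((chartAt E g).symm a)) a
          (chartField (chartAt E g) X a)) := by
      have hUo : IsOpen ((chartAt E g).target ∩ (chartAt E g).symm ⁻¹' U) :=
        (chartAt E g).isOpen_inter_preimage_symm hU
      filter_upwards [hUo.mem_nhds ⟨hget, by simpa [(chartAt E g).left_inv hge] using hg⟩]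
        with a ha
      have h3 := alongDeriv_eq_fderiv he ((chartAt E g).map_target ha.1)
        ((hφ _ ⟨ha.2, (chartAt E g).map_target ha.1⟩).differentiableAt (by simp)) X
      rwa [(chartAt E g).right_inv ha.1] at h3
    rw [alongDeriv_eq_fderiv he hge (h2.differentiableAt_iff.2 h1), h2.fderiv_eq]
  rw [hder W V hW, hder V W hV,
    fderiv_fderiv_apply_sub (hφ g ⟨hg, hge⟩) (hpull_diff V hV) (hpull_diff W hW),
    alongDeriv_eq_fderiv he hge ((hφ g ⟨hg, hge⟩).differentiableAt (by simp)),
    chartField_apply _ hge]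
  refine congrArg _ ?_
  -- `mlieBracket` applies the inverse of the differential of the chart to the bracket of the
  -- transported fields, and the differential of the chart undoes it.
  have hA : (mfderiv 𝓘(ℝ, E) 𝓘(ℝ, E) (extChartAt 𝓘(ℝ, E) g) g : E →L[ℝ] E).IsInvertible :=
    isInvertible_mfderiv_extChartAt (mem_extChartAt_source g)
  have hL : VectorField.lieBracketWithin ℝ
      (VectorField.mpullbackWithin 𝓘(ℝ, E) 𝓘(ℝ, E) (extChartAt 𝓘(ℝ, E) g).symm V (range 𝓘(ℝ, E)))
      (VectorField.mpullbackWithin 𝓘(ℝ, E) 𝓘(ℝ, E) (extChartAt 𝓘(ℝ, E) g).symm W (range 𝓘(ℝ, E)))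
      ((extChartAt 𝓘(ℝ, E) g).symm ⁻¹' univ ∩ range 𝓘(ℝ, E)) (chartAt E g g) =
      VectorField.lieBracket ℝ (chartField (chartAt E g) V) (chartField (chartAt E g) W)
        (chartAt E g g) := by
    have huniv : (extChartAt 𝓘(ℝ, E) g).symm ⁻¹' univ ∩ range 𝓘(ℝ, E) = univ := by simp
    have h1 : ∀ X Z : E → E, VectorField.lieBracketWithin ℝ X Z
        ((extChartAt 𝓘(ℝ, E) g).symm ⁻¹' univ ∩ range 𝓘(ℝ, E)) (chartAt E g g) =
        VectorField.lieBracket ℝ X Z (chartAt E g g) := by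
      intro X Z
      rw [huniv, VectorField.lieBracketWithin_univ]
    exact (h1 _ _).trans
      (Filter.EventuallyEq.lieBracket_vectorField_eq (𝕜 := ℝ) (hpull V) (hpull W))
  exact ((hA.self_apply_inverse _).trans hL).symm

end VectorField

/-- `X_v X_u f - X_u X_v f = X_{[v, u]} f`. -/
theorem leftDeriv_leftDeriv_sub [CompleteSpace E] {f : G → F} {U : Set G} (hU : IsOpen U)
    (hf : ContMDiffOn 𝓘(ℝ, E) 𝓘(ℝ, F) ∞ f U) {g : G} (hg : g ∈ U)
    (v u : GroupLieAlgebra 𝓘(ℝ, E) G) :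
    (leftDeriv (leftDeriv f : G → E →L[ℝ] F) g : E →L[ℝ] E →L[ℝ] F) v u -
      (leftDeriv (leftDeriv f : G → E →L[ℝ] F) g : E →L[ℝ] E →L[ℝ] F) u v =
      (leftDeriv f g : E →L[ℝ] F) (⁅v, u⁆ : GroupLieAlgebra 𝓘(ℝ, E) G) := by
  have hL : LieGroup 𝓘(ℝ, E) (minSmoothness ℝ 3) G := by
    rw [minSmoothness_of_isRCLikeNormedField]
    exact LieGroup.of_le (n := ∞) (WithTop.coe_le_coe.2 le_top)
  have hd : ∀ x ∈ U, MDifferentiableAt 𝓘(ℝ, E) 𝓘(ℝ, F) f x := fun x hx =>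
    (hf.contMDiffAt (hU.mem_nhds hx)).mdifferentiableAt (by simp)
  have hX : ∀ w : E, (fun x => (leftDeriv f x : E →L[ℝ] F) w) =ᶠ[𝓝 g]
      alongDeriv (mulInvariantVectorField (I := 𝓘(ℝ, E)) (G := G) w) f := by
    intro w
    filter_upwards [hU.mem_nhds hg] with x hx
    exact leftDeriv_apply (hd x hx) w
  have hXd : ∀ w : E, MDifferentiableAt 𝓘(ℝ, E) 𝓘(ℝ, F)
      (fun x => (leftDeriv f x : E →L[ℝ] F) w) g := fun w =>
    (((contMDiffOn_leftDeriv hU hf).clm_apply contMDiffOn_const).contMDiffAt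
      (hU.mem_nhds hg)).mdifferentiableAt (by simp)
  have hXX : ∀ v w : E, (leftDeriv (leftDeriv f : G → E →L[ℝ] F) g : E →L[ℝ] E →L[ℝ] F) v w =
      alongDeriv (mulInvariantVectorField (I := 𝓘(ℝ, E)) (G := G) v)
        (alongDeriv (mulInvariantVectorField (I := 𝓘(ℝ, E)) (G := G) w) f) g := by
    intro v w
    rw [← leftDeriv_leftDeriv_apply hU hf hg, leftDeriv_apply (hXd w)]
    exact congrArg (fun L : E →L[ℝ] F => L (mulInvariantVectorField (I := 𝓘(ℝ, E)) v g))
      (hX w).mfderiv_eq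
  have key := alongDeriv_mlieBracket hU hf hg
    (mdifferentiableAt_mulInvariantVectorField (I := 𝓘(ℝ, E)) v)
    (mdifferentiableAt_mulInvariantVectorField (I := 𝓘(ℝ, E)) u)
  refine (congrArg₂ (fun a b : F => a - b) (hXX v u) (hXX u v)).trans (key.trans ?_)
  rw [← mulInvariantVector_mlieBracket]
  exact (leftDeriv_apply (hd g hg) _).symm

end LeftDeriv

end

end HomogeneousSpray

namespace HomogeneousSpray

noncomputable section

/-- As `m` is a complement of the kernel of `A`, the restriction of `A` to `m` is a linear
isomorphism onto `F`. The map `R` is its inverse, viewed in `E`. -/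
theorem exists_rightInverse_mem_complement {E F : Type*} [NormedAddCommGroup E] [NormedSpace ℝ E]
    [NormedAddCommGroup F] [NormedSpace ℝ F] [FiniteDimensional ℝ F] (A : E →L[ℝ] F)
    (hA : Function.Surjective A) {k m : Submodule ℝ E} (hm : IsCompl k m)
    (hk : ∀ v, A v = 0 ↔ v ∈ k) :
    ∃ R : F →L[ℝ] E, (∀ z, R z ∈ m) ∧ (∀ z, A (R z) = z) ∧ ∀ v ∈ m, R (A v) = v := by
  have hinj : ∀ v ∈ m, A v = 0 → v = 0 := fun v hv h =>
    Submodule.disjoint_def.1 hm.disjoint v ((hk v).1 h) hv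
  let B : m →ₗ[ℝ] F := A.toLinearMap.comp m.subtype
  have hB : Function.Surjective B := by
    intro z
    obtain ⟨v, rfl⟩ := hA z
    have hv : v ∈ k ⊔ m := hm.codisjoint.eq_top ▸ Submodule.mem_top
    obtain ⟨a, ha, b, hb, rfl⟩ := Submodule.mem_sup.1 hv
    refine ⟨⟨b, hb⟩, ?_⟩
    change A b = A (a + b)
    rw [map_add, (hk a).2 ha, zero_add]
  obtain ⟨R, hR⟩ := B.exists_rightInverse_of_surjective (LinearMap.range_eq_top.2 hB)
  have hAR : ∀ z, A (R z) = z := fun z => congrArg (fun L : F →ₗ[ℝ] F => L z) hR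
  refine ⟨(m.subtype.comp R).toContinuousLinearMap, fun z => (R z).2, hAR, fun v hv => ?_⟩
  have h1 : A (R (A v) - v) = 0 := by rw [map_sub, hAR, sub_self]
  exact sub_eq_zero.1 (hinj _ (m.sub_mem (R (A v)).2 hv) h1)

/-! ### Local sections and fibres of submersions -/

section Submersion

variable {E : Type*} [NormedAddCommGroup E] [NormedSpace ℝ E]
  {F : Type*} [NormedAddCommGroup F] [NormedSpace ℝ F]
  {M : Type*} [TopologicalSpace M] [ChartedSpace E M]
  {N : Type*} [TopologicalSpace N] [ChartedSpace F N]

/-- The local normal form, with the splitting of `E` hidden in the projection `p` and the section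
`s`. -/
theorem IsSubmersion.exists_charts {f : M → N}
    (hf : Manifold.IsSubmersion 𝓘(ℝ, E) 𝓘(ℝ, F) ∞ f) (x : M) :
    ∃ e ∈ IsManifold.maximalAtlas 𝓘(ℝ, E) ∞ M, ∃ e' ∈ IsManifold.maximalAtlas 𝓘(ℝ, F) ∞ N,
      x ∈ e.source ∧ MapsTo f e.source e'.source ∧
      ∃ p : E →L[ℝ] F, ∃ s : F →L[ℝ] E, (∀ z, p (s z) = z) ∧
        ∀ a ∈ e.target, e' (f (e.symm a)) = p a := by
  obtain ⟨C, _, _, h⟩ := (hf : Manifold.IsSubmersion 𝓘(ℝ, E) 𝓘(ℝ, F) ∞ f)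
  have h := h x
  refine ⟨h.domChart, h.domChart_mem_maximalAtlas, h.codChart, h.codChart_mem_maximalAtlas,
    h.mem_domChart_source, h.mapsto_domChart_source_codChart_source,
    (ContinuousLinearMap.fst ℝ F C).comp h.equiv.toContinuousLinearMap,
    h.equiv.symm.toContinuousLinearMap.comp (ContinuousLinearMap.inl ℝ F C), ?_, ?_⟩
  · intro z
    simp
  · intro a ha
    have ha' : a ∈ (h.domChart.extend 𝓘(ℝ, E)).target := by
      rw [OpenPartialHomeomorph.extend_target]
      simpa using ha
    have := h.writtenInCharts ha'
    simpa using this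

theorem IsSubmersion.exists_section {f : M → N}
    (hf : Manifold.IsSubmersion 𝓘(ℝ, E) 𝓘(ℝ, F) ∞ f) (x : M) :
    ∃ σ : N → M, ContMDiffAt 𝓘(ℝ, F) 𝓘(ℝ, E) ∞ σ (f x) ∧ σ (f x) = x ∧
      ∀ᶠ z in 𝓝 (f x), f (σ z) = z := by
  obtain ⟨e, he, e', he', hx, hmaps, p, s, hps, hcoord⟩ := IsSubmersion.exists_charts hf x
  have hfx : e' (f x) = p (e x) := by
    have := hcoord (e x) (e.map_source hx)
    rwa [e.left_inv hx] at this
  -- The affine section of `p` through `e x`, read in the charts.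
  let τ : N → E := fun z => e x + s (e' z - e' (f x))
  have hτ : ContMDiffAt 𝓘(ℝ, F) 𝓘(ℝ, E) ∞ τ (f x) := by
    have h1 : ContMDiffAt 𝓘(ℝ, F) 𝓘(ℝ, F) ∞ e' (f x) :=
      (contMDiffOn_of_mem_maximalAtlas he').contMDiffAt (e'.open_source.mem_nhds (hmaps hx))
    have h2 : ContDiff ℝ ∞ (fun b : F => e x + s (b - e' (f x))) := by fun_prop
    exact h2.contMDiff.contMDiffAt.comp (f x) h1
  have hτx : τ (f x) = e x := by simp [τ]
  have hτmem : ∀ᶠ z in 𝓝 (f x), τ z ∈ e.target :=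
    hτ.continuousAt.eventually_mem (hτx ▸ e.open_target.mem_nhds (e.map_source hx))
  refine ⟨fun z => e.symm (τ z), ?_, ?_, ?_⟩
  · refine ContMDiffAt.comp (f x) (I' := 𝓘(ℝ, E)) (g := e.symm) ?_ hτ
    rw [hτx]
    exact (contMDiffOn_symm_of_mem_maximalAtlas he).contMDiffAt
      (e.open_target.mem_nhds (e.map_source hx))
  · change e.symm (τ (f x)) = x
    rw [hτx, e.left_inv hx]
  · filter_upwards [hτmem, e'.open_source.mem_nhds (hmaps hx)] with z hz hz'
    refine e'.injOn (hmaps (e.map_target hz)) hz' ?_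
    rw [hcoord _ hz]
    simp [τ, hps, hfx]

/-- In adapted charts the map is linear, so a kernel vector generates a straight line contained in
the fibre. -/
theorem IsSubmersion.exists_curve_in_fiber {f : M → N}
    (hf : Manifold.IsSubmersion 𝓘(ℝ, E) 𝓘(ℝ, F) ∞ f) (x : M) (v : TangentSpace 𝓘(ℝ, E) x)
    (hv : mfderiv 𝓘(ℝ, E) 𝓘(ℝ, F) f x v = 0) :
    ∃ ε : ℝ, 0 < ε ∧ ∃ γ : ℝ → M, ContMDiffOn 𝓘(ℝ, ℝ) 𝓘(ℝ, E) ∞ γ (Ioo (-ε) ε) ∧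
      (∀ t ∈ Ioo (-ε) ε, f (γ t) = f x) ∧ γ 0 = x ∧
      (mfderiv 𝓘(ℝ, ℝ) 𝓘(ℝ, E) γ 0 (1 : ℝ) : E) = (v : E) := by
  obtain ⟨e, he, e', he', hx, hmaps, p, s, hps, hcoord⟩ := IsSubmersion.exists_charts hf x
  let u : E := mfderiv 𝓘(ℝ, E) 𝓘(ℝ, E) e x v
  have hfd : MDifferentiableAt 𝓘(ℝ, E) 𝓘(ℝ, F) f x :=
    hf.contMDiff.mdifferentiable (by simp) x
  have hpu : p u = 0 := by
    have h1 := (mdifferentiableAt_of_mem_maximalAtlas he' (hmaps hx)).hasMFDerivAt.comp x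
      hfd.hasMFDerivAt
    have h2 : HasMFDerivAt 𝓘(ℝ, E) 𝓘(ℝ, F) (e' ∘ f) x
        (p.comp (mfderiv 𝓘(ℝ, E) 𝓘(ℝ, E) e x : E →L[ℝ] E)) := by
      refine (p.hasFDerivAt.hasMFDerivAt.comp x
        (mdifferentiableAt_of_mem_maximalAtlas he hx).hasMFDerivAt).congr_of_eventuallyEq ?_
      filter_upwards [e.open_source.mem_nhds hx] with z hz
      have := hcoord (e z) (e.map_source hz)
      rwa [e.left_inv hz] at this
    have h3 := congrArg (fun L : E →L[ℝ] F => L v) (hasMFDerivAt_unique h2 h1)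
    refine h3.trans ?_
    change (mfderiv 𝓘(ℝ, F) 𝓘(ℝ, F) e' (f x)) (mfderiv 𝓘(ℝ, E) 𝓘(ℝ, F) f x v) = 0
    rw [hv]
    exact ContinuousLinearMap.map_zero _
  have hline : ContDiff ℝ ∞ (fun t : ℝ => e x + t • u) := by fun_prop
  have hmem : ∀ᶠ t in 𝓝 (0 : ℝ), e x + t • u ∈ e.target :=
    hline.continuous.continuousAt.eventually_mem
      (e.open_target.mem_nhds (by simpa using e.map_source hx))
  obtain ⟨ε, hε, hball⟩ := Metric.eventually_nhds_iff_ball.1 hmem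
  rw [Real.ball_eq_Ioo, zero_sub, zero_add] at hball
  refine ⟨ε, hε, fun t => e.symm (e x + t • u), ?_, ?_, ?_, ?_⟩
  · exact (contMDiffOn_symm_of_mem_maximalAtlas he).comp hline.contMDiff.contMDiffOn hball
  · intro t ht
    refine e'.injOn (hmaps (e.map_target (hball t ht))) (hmaps hx) ?_
    have h1 := hcoord (e x) (e.map_source hx)
    rw [e.left_inv hx] at h1
    rw [hcoord _ (hball t ht), h1]
    simp [hpu]
  · simp [e.left_inv hx]
  · have h0 : ∀ a, a = e x → HasMFDerivAt 𝓘(ℝ, E) 𝓘(ℝ, E) e.symm a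
        (mfderiv 𝓘(ℝ, E) 𝓘(ℝ, E) e.symm (e x) : E →L[ℝ] E) := by
      rintro _ rfl
      exact (mdifferentiableAt_symm_of_mem_maximalAtlas he (e.map_source hx)).hasMFDerivAt
    have h1 : HasDerivAt (fun t : ℝ => e x + t • u) u 0 := by
      simpa using ((hasDerivAt_id (0 : ℝ)).smul_const u).const_add (e x)
    have h2 := (h0 (e x + (0 : ℝ) • u) (by simp)).comp (0 : ℝ) h1.hasFDerivAt.hasMFDerivAt
    have h3 := congrArg (fun L : ℝ →L[ℝ] E => L 1) h2.mfderiv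
    have h4 := congrArg (fun L : E →L[ℝ] E => L v)
      ((mdifferentiable_of_mem_maximalAtlas he).symm_comp_deriv hx)
    refine h3.trans (Eq.trans ?_ h4)
    have h5 : (ContinuousLinearMap.toSpanSingleton ℝ u : ℝ →L[ℝ] E) 1 = u := by simp
    exact congrArg (mfderiv 𝓘(ℝ, E) 𝓘(ℝ, E) e.symm (e x) : E →L[ℝ] E) h5

end Submersion

/-! ### The coset space: differential of the projection and of the action -/

section Coset

variable {E : Type*} [NormedAddCommGroup E] [NormedSpace ℝ E]
  {F : Type*} [NormedAddCommGroup F] [NormedSpace ℝ F]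
  {G : Type*} [TopologicalSpace G] [ChartedSpace E G] [Group G]
  {H : Subgroup G} [ChartedSpace F (G ⧸ H)]

theorem contMDiff_mk (hGH : IsSmoothCosetSpace E F H) :
    ContMDiff 𝓘(ℝ, E) 𝓘(ℝ, F) ∞ (QuotientGroup.mk : G → G ⧸ H) :=
  Manifold.IsSubmersion.contMDiff hGH

theorem mdifferentiableAt_mk (hGH : IsSmoothCosetSpace E F H) (g : G) :
    MDifferentiableAt 𝓘(ℝ, E) 𝓘(ℝ, F) (QuotientGroup.mk : G → G ⧸ H) g :=
  (contMDiff_mk hGH).mdifferentiable (by simp) g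

/-- The function on `G` induced by a chart of `G ⧸ H`. -/
def cosetChart (e : OpenPartialHomeomorph (G ⧸ H) F) (g : G) : F :=
  e (QuotientGroup.mk g)

variable {e : OpenPartialHomeomorph (G ⧸ H) F}

theorem isOpen_mk_preimage_source (hGH : IsSmoothCosetSpace E F H) :
    IsOpen ((QuotientGroup.mk : G → G ⧸ H) ⁻¹' e.source) :=
  e.open_source.preimage (contMDiff_mk hGH).continuous

theorem contMDiffOn_cosetChart (hGH : IsSmoothCosetSpace E F H)
    (he : e ∈ IsManifold.maximalAtlas 𝓘(ℝ, F) ∞ (G ⧸ H)) :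
    ContMDiffOn 𝓘(ℝ, E) 𝓘(ℝ, F) ∞ (cosetChart e) ((QuotientGroup.mk : G → G ⧸ H) ⁻¹' e.source) :=
  (contMDiffOn_of_mem_maximalAtlas he).comp (contMDiff_mk hGH).contMDiffOn fun _ hx => hx

theorem mdifferentiableAt_cosetChart (hGH : IsSmoothCosetSpace E F H)
    (he : e ∈ IsManifold.maximalAtlas 𝓘(ℝ, F) ∞ (G ⧸ H)) {g : G}
    (hg : (QuotientGroup.mk g : G ⧸ H) ∈ e.source) :
    MDifferentiableAt 𝓘(ℝ, E) 𝓘(ℝ, F) (cosetChart e : G → F) g :=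
  ((contMDiffOn_cosetChart hGH he).contMDiffAt
    ((isOpen_mk_preimage_source hGH).mem_nhds hg)).mdifferentiableAt (by simp)

theorem mfderiv_mk_surjective (hGH : IsSmoothCosetSpace E F H) (z : F) :
    ∃ v : E, (mfderiv 𝓘(ℝ, E) 𝓘(ℝ, F) (QuotientGroup.mk : G → G ⧸ H) 1 : E →L[ℝ] F) v = z := by
  obtain ⟨σ, hσ, hσ1, hσ'⟩ := IsSubmersion.exists_section hGH (1 : G)
  have h1 : ∀ x, x = (1 : G) →
      HasMFDerivAt 𝓘(ℝ, E) 𝓘(ℝ, F) (QuotientGroup.mk : G → G ⧸ H) x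
        (mfderiv 𝓘(ℝ, E) 𝓘(ℝ, F) (QuotientGroup.mk : G → G ⧸ H) 1 : E →L[ℝ] F) := by
    rintro _ rfl
    exact (mdifferentiableAt_mk hGH 1).hasMFDerivAt
  have h2 := (h1 _ hσ1).comp (QuotientGroup.mk 1 : G ⧸ H)
    (hσ.mdifferentiableAt (by simp)).hasMFDerivAt
  have h3 := (hasMFDerivAt_id (I := 𝓘(ℝ, F)) (QuotientGroup.mk 1 : G ⧸ H)).congr_of_eventuallyEq hσ'
  exact ⟨_, congrArg (fun L : F →L[ℝ] F => L z) (hasMFDerivAt_unique h2 h3)⟩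

variable [LieGroup 𝓘(ℝ, E) ∞ G]

/-- Near any point the translation equals `x ↦ π (g * σ x)` for a smooth local section `σ` of the
projection. -/
theorem contMDiff_smul_coset (hGH : IsSmoothCosetSpace E F H) (g : G) :
    ContMDiff 𝓘(ℝ, F) 𝓘(ℝ, F) ∞ (fun x : G ⧸ H => g • x) := by
  intro x
  obtain ⟨a, rfl⟩ := QuotientGroup.mk_surjective x
  obtain ⟨σ, hσ, -, hσ'⟩ := IsSubmersion.exists_section hGH a
  have h1 : ContMDiffAt 𝓘(ℝ, F) 𝓘(ℝ, F) ∞ (fun x : G ⧸ H => (QuotientGroup.mk (g * σ x) : G ⧸ H))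
      (QuotientGroup.mk a) :=
    (((contMDiff_mk hGH).comp (contMDiff_mul_left (a := g))).contMDiffAt).comp _ hσ
  refine h1.congr_of_eventuallyEq ?_
  filter_upwards [hσ'] with z hz
  conv_lhs => rw [← hz]
  rfl

theorem mdifferentiableAt_smul_coset (hGH : IsSmoothCosetSpace E F H) (g : G) (x : G ⧸ H) :
    MDifferentiableAt 𝓘(ℝ, F) 𝓘(ℝ, F) (fun x : G ⧸ H => g • x) x :=
  (contMDiff_smul_coset hGH g).mdifferentiable (by simp) x

/-- A kernel vector is the velocity of a curve in the fibre through `1`, which is `H`. Conversely,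
the projection is constant along a curve in `H`. -/
theorem mfderiv_mk_eq_zero_iff (hGH : IsSmoothCosetSpace E F H)
    (v : GroupLieAlgebra 𝓘(ℝ, E) G) :
    (mfderiv 𝓘(ℝ, E) 𝓘(ℝ, F) (QuotientGroup.mk : G → G ⧸ H) 1 v : F) = 0 ↔
      v ∈ subgroupLieAlgebra E H := by
  constructor
  · intro hv
    obtain ⟨ε, hε, γ, hγ, hfib, h0, hd⟩ := IsSubmersion.exists_curve_in_fiber hGH (1 : G) v hv
    refine ⟨ε, hε, γ, hγ, fun t ht => ?_, velocity_eq_iff.2 ⟨h0, hd⟩⟩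
    have h := QuotientGroup.eq.1 (hfib t ht).symm
    simpa using h
  · rintro ⟨ε, hε, γ, hγ, hH, hv⟩
    obtain ⟨h0, hd⟩ := velocity_eq_iff.1 hv
    have hmem : Ioo (-ε) ε ∈ 𝓝 (0 : ℝ) := isOpen_Ioo.mem_nhds (by simp [hε])
    have hγd : MDifferentiableAt 𝓘(ℝ, ℝ) 𝓘(ℝ, E) γ 0 :=
      (hγ.contMDiffAt hmem).mdifferentiableAt (by simp)
    have h1 : ∀ x, x = (1 : G) →
        HasMFDerivAt 𝓘(ℝ, E) 𝓘(ℝ, F) (QuotientGroup.mk : G → G ⧸ H) x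
          (mfderiv 𝓘(ℝ, E) 𝓘(ℝ, F) (QuotientGroup.mk : G → G ⧸ H) 1 : E →L[ℝ] F) := by
      rintro _ rfl
      exact (mdifferentiableAt_mk hGH 1).hasMFDerivAt
    have h2 := (h1 (γ 0) h0).comp (0 : ℝ) hγd.hasMFDerivAt
    have h3 : HasMFDerivAt 𝓘(ℝ, ℝ) 𝓘(ℝ, F) ((QuotientGroup.mk : G → G ⧸ H) ∘ γ) 0
        (0 : ℝ →L[ℝ] F) := by
      refine (hasMFDerivAt_const (QuotientGroup.mk 1 : G ⧸ H) (0 : ℝ)).congr_of_eventuallyEq ?_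
      filter_upwards [hmem] with t ht
      refine (QuotientGroup.eq.2 ?_).symm
      simpa using hH t ht
    have h4 := congrArg (fun L : ℝ →L[ℝ] F => L 1) (hasMFDerivAt_unique h2 h3)
    refine Eq.trans ?_ h4
    exact congrArg (mfderiv 𝓘(ℝ, E) 𝓘(ℝ, F) (QuotientGroup.mk : G → G ⧸ H) 1 : E →L[ℝ] F) hd.symm

theorem mfderiv_smul_inv_smul (hGH : IsSmoothCosetSpace E F H) (g : G) (x : G ⧸ H) (z : F) :
    (mfderiv 𝓘(ℝ, F) 𝓘(ℝ, F) (fun x : G ⧸ H => g⁻¹ • x) (g • x) : F →L[ℝ] F)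
      ((mfderiv 𝓘(ℝ, F) 𝓘(ℝ, F) (fun x : G ⧸ H => g • x) x : F →L[ℝ] F) z) = z := by
  have h1 := (mdifferentiableAt_smul_coset hGH g⁻¹ (g • x)).hasMFDerivAt.comp x
    (mdifferentiableAt_smul_coset hGH g x).hasMFDerivAt
  have h2 : HasMFDerivAt 𝓘(ℝ, F) 𝓘(ℝ, F) ((fun x : G ⧸ H => g⁻¹ • x) ∘ (fun x => g • x)) x
      (ContinuousLinearMap.id ℝ F) :=
    (hasMFDerivAt_id x).congr_of_eventuallyEq (Filter.Eventually.of_forall fun x => by simp)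
  exact congrArg (fun L : F →L[ℝ] F => L z) (hasMFDerivAt_unique h1 h2)

theorem mfderiv_smul_smul_inv (hGH : IsSmoothCosetSpace E F H) (g : G) (x : G ⧸ H) (z : F) :
    ∃ z' : F, (mfderiv 𝓘(ℝ, F) 𝓘(ℝ, F) (fun x : G ⧸ H => g • x) x : F →L[ℝ] F) z' = z := by
  have h := mfderiv_smul_inv_smul hGH g⁻¹ (g • x) z
  have h1 : ∀ a b : G, ∀ y y' : G ⧸ H, a = g → y = x → 
      (mfderiv 𝓘(ℝ, F) 𝓘(ℝ, F) (fun x : G ⧸ H => a • x) y : F →L[ℝ] F) = 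
      (mfderiv 𝓘(ℝ, F) 𝓘(ℝ, F) (fun x : G ⧸ H => g • x) x : F →L[ℝ] F) := by
    rintro _ _ _ _ rfl rfl
    rfl
  have h2 := h1 g⁻¹⁻¹ 1 (g⁻¹ • g • x) x (inv_inv g) (inv_smul_smul g x)
  exact ⟨_, (congrArg (fun L : F →L[ℝ] F => L _) h2).symm.trans h⟩

/-- Chain rule at `1` for `e (g • π h) = e (π (g * h))`. This makes `leftDeriv (cosetChart e) g` the
coordinate form of the map `v ↦ g_* v`. -/
theorem tangentChart_push_toOrigin (hGH : IsSmoothCosetSpace E F H)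
    (he : e ∈ IsManifold.maximalAtlas 𝓘(ℝ, F) ∞ (G ⧸ H)) {g : G}
    (hg : (QuotientGroup.mk g : G ⧸ H) ∈ e.source) (v : GroupLieAlgebra 𝓘(ℝ, E) G) :
    (tangentChart e (push g (toOrigin H v))).2 = (leftDeriv (cosetChart e) g : E →L[ℝ] F) v := by
  have hg' : g • (QuotientGroup.mk 1 : G ⧸ H) ∈ e.source := by
    have : g • (QuotientGroup.mk 1 : G ⧸ H) = QuotientGroup.mk g :=
      congrArg QuotientGroup.mk (mul_one g)
    rwa [this]
  have h1 := (mdifferentiableAt_of_mem_maximalAtlas he hg').hasMFDerivAt.comp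
    (QuotientGroup.mk 1 : G ⧸ H)
    (mdifferentiableAt_smul_coset hGH g (QuotientGroup.mk 1 : G ⧸ H)).hasMFDerivAt
  have h2 := h1.comp (1 : G) (mdifferentiableAt_mk hGH (1 : G)).hasMFDerivAt
  exact (congrArg (fun L : E →L[ℝ] F => L v) h2.mfderiv).symm

/-- The differentials of the chart and of the translation by `g` are injective, so the kernel is
that of the projection at `1`, whatever `g` is. -/
theorem leftDeriv_cosetChart_eq_zero_iff (hGH : IsSmoothCosetSpace E F H)
    (he : e ∈ IsManifold.maximalAtlas 𝓘(ℝ, F) ∞ (G ⧸ H)) {g : G}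
    (hg : (QuotientGroup.mk g : G ⧸ H) ∈ e.source) (v : GroupLieAlgebra 𝓘(ℝ, E) G) :
    (leftDeriv (cosetChart e) g : E →L[ℝ] F) v = 0 ↔ v ∈ subgroupLieAlgebra E H := by
  have hg' : g • (QuotientGroup.mk 1 : G ⧸ H) ∈ e.source := by
    have : g • (QuotientGroup.mk 1 : G ⧸ H) = QuotientGroup.mk g :=
      congrArg QuotientGroup.mk (mul_one g)
    rwa [this]
  rw [← mfderiv_mk_eq_zero_iff hGH, ← tangentChart_push_toOrigin hGH he hg,
    tangentChart_snd_eq_zero_iff he (p := push g (toOrigin H v)) hg']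
  constructor
  · intro h
    have h1 := mfderiv_smul_inv_smul hGH g (QuotientGroup.mk 1)
      (mfderiv 𝓘(ℝ, E) 𝓘(ℝ, F) (QuotientGroup.mk : G → G ⧸ H) 1 v)
    refine h1.symm.trans ?_
    exact (congrArg (mfderiv 𝓘(ℝ, F) 𝓘(ℝ, F) (fun x : G ⧸ H => g⁻¹ • x)
      (g • (QuotientGroup.mk 1)) : F →L[ℝ] F) h).trans (ContinuousLinearMap.map_zero _)
  · intro h
    exact (congrArg (mfderiv 𝓘(ℝ, F) 𝓘(ℝ, F) (fun x : G ⧸ H => g • x)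
      (QuotientGroup.mk 1) : F →L[ℝ] F) h).trans (ContinuousLinearMap.map_zero _)

theorem leftDeriv_cosetChart_surjective (hGH : IsSmoothCosetSpace E F H)
    (he : e ∈ IsManifold.maximalAtlas 𝓘(ℝ, F) ∞ (G ⧸ H)) {g : G}
    (hg : (QuotientGroup.mk g : G ⧸ H) ∈ e.source) (z : F) :
    ∃ v : E, (leftDeriv (cosetChart e) g : E →L[ℝ] F) v = z := by
  have hg' : g • (QuotientGroup.mk 1 : G ⧸ H) ∈ e.source := by
    have : g • (QuotientGroup.mk 1 : G ⧸ H) = QuotientGroup.mk g :=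
      congrArg QuotientGroup.mk (mul_one g)
    rwa [this]
  obtain ⟨z₂, h₂⟩ := mfderiv_smul_smul_inv hGH g (QuotientGroup.mk 1)
    ((mfderiv 𝓘(ℝ, F) 𝓘(ℝ, F) e.symm (e (g • (QuotientGroup.mk 1))) : F →L[ℝ] F) z)
  obtain ⟨v, hv⟩ := mfderiv_mk_surjective hGH z₂
  refine ⟨v, (tangentChart_push_toOrigin hGH he hg v).symm.trans ?_⟩
  have h3 := (mdifferentiable_of_mem_maximalAtlas he).comp_symm_deriv (e.map_source hg')
  rw [e.left_inv hg'] at h3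
  refine Eq.trans ?_ (congrArg (fun L : F →L[ℝ] F => L z) h3)
  refine congrArg (mfderiv 𝓘(ℝ, F) 𝓘(ℝ, F) e (g • (QuotientGroup.mk 1)) : F →L[ℝ] F) ?_
  refine Eq.trans ?_ h₂
  exact congrArg (mfderiv 𝓘(ℝ, F) 𝓘(ℝ, F) (fun x : G ⧸ H => g • x) (QuotientGroup.mk 1) :
    F →L[ℝ] F) hv

theorem tangentChart_velocity_mk (hGH : IsSmoothCosetSpace E F H)
    (he : e ∈ IsManifold.maximalAtlas 𝓘(ℝ, F) ∞ (G ⧸ H)) {γ : ℝ → G} {t : ℝ}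
    (hγ : MDifferentiableAt 𝓘(ℝ, ℝ) 𝓘(ℝ, E) γ t)
    (ht : (QuotientGroup.mk (γ t) : G ⧸ H) ∈ e.source) :
    (tangentChart e (velocity (fun s => (QuotientGroup.mk (γ s) : G ⧸ H)) t)).2 =
      (leftDeriv (cosetChart e) (γ t) : E →L[ℝ] F) (leftVelocity γ t) :=
  (mfderiv_chart_comp he ((mdifferentiableAt_mk hGH (γ t)).comp t hγ) ht).unique
    (hasDerivAt_comp_leftDeriv hγ (mdifferentiableAt_cosetChart hGH he ht))

/-- A right inverse, with values in the complement `m` of `𝔥`, of the differential of a chart of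
`G ⧸ H` pulled back to `G`. -/
theorem exists_rightInverse_leftDeriv_cosetChart [FiniteDimensional ℝ F]
    (hGH : IsSmoothCosetSpace E F H)
    (he : e ∈ IsManifold.maximalAtlas 𝓘(ℝ, F) ∞ (G ⧸ H)) {g : G}
    (hg : (QuotientGroup.mk g : G ⧸ H) ∈ e.source)
    {m : Submodule ℝ (GroupLieAlgebra 𝓘(ℝ, E) G)} (hm : IsCompl (subgroupLieAlgebra E H) m) :
    ∃ R : F →L[ℝ] E, (∀ z, (R z : GroupLieAlgebra 𝓘(ℝ, E) G) ∈ m) ∧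
      (∀ z, (leftDeriv (cosetChart e) g : E →L[ℝ] F) (R z) = z) ∧
      ∀ v ∈ m, R ((leftDeriv (cosetChart e) g : E →L[ℝ] F) v) = v := by
  exact exists_rightInverse_mem_complement (E := E) (leftDeriv (cosetChart e) g)
    (leftDeriv_cosetChart_surjective hGH he hg) hm (leftDeriv_cosetChart_eq_zero_iff hGH he hg)

end Coset

end

end HomogeneousSpray

/-! ### Curves in the group with prescribed left velocity -/

namespace HomogeneousSpray

noncomputable section

/-- Local existence and smoothness for autonomous smooth ordinary differential equations. -/
theorem exists_contDiffOn_hasDerivAt_of_contDiffOn {V : Type*} [NormedAddCommGroup V]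
    [NormedSpace ℝ V] [CompleteSpace V] {f : V → V} {U : Set V} (hU : IsOpen U)
    (hf : ContDiffOn ℝ ∞ f U) {x₀ : V} (hx₀ : x₀ ∈ U) :
    ∃ ε : ℝ, 0 < ε ∧ ∃ α : ℝ → V, α 0 = x₀ ∧ ContDiffOn ℝ ∞ α (Ioo (-ε) ε) ∧
      ∀ t ∈ Ioo (-ε) ε, α t ∈ U ∧ HasDerivAt α (f (α t)) t := by
  have h1 : ContDiffAt ℝ 1 f x₀ :=
    (hf.contDiffAt (hU.mem_nhds hx₀)).of_le (WithTop.coe_le_coe.2 le_top)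
  obtain ⟨α, hα0, ε, hε, hα⟩ := h1.exists_forall_mem_closedBall_exists_eq_forall_mem_Ioo_hasDerivAt₀ 0
  rw [zero_sub, zero_add] at hα
  have hcont : ContinuousAt α 0 := (hα 0 (by simp [hε])).continuousAt
  obtain ⟨δ, hδ, hball⟩ := Metric.eventually_nhds_iff_ball.1
    (hcont.eventually_mem (hα0 ▸ hU.mem_nhds hx₀))
  rw [Real.ball_eq_Ioo, zero_sub, zero_add] at hball
  -- Halving keeps the closed interval `[-r, r]` inside both open ones, since smoothness of
  -- solutions is obtained on a closed interval.
  set r := min ε δ / 2 with hr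
  have hr0 : 0 < r := by positivity
  have hrε : r < ε := by have := min_le_left ε δ; have := lt_min hε hδ; linarith
  have hrδ : r < δ := by have := min_le_right ε δ; have := lt_min hε hδ; linarith
  have hIcc : ∀ t ∈ Icc (-r) r, α t ∈ U ∧ HasDerivAt α (f (α t)) t := fun t ht =>
    ⟨hball t ⟨by linarith [ht.1], by linarith [ht.2]⟩,
      hα t ⟨by linarith [ht.1], by linarith [ht.2]⟩⟩
  refine ⟨r, hr0, α, hα0, ?_, fun t ht => hIcc t (Ioo_subset_Icc_self ht)⟩
  refine (ODE.contDiffOn_enat_Icc_of_hasDerivWithinAt (f := fun _ => f) (u := U) (n := ⊤) ?_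
    (fun t ht => (hIcc t ht).2.hasDerivWithinAt) (fun t ht => (hIcc t ht).1)).mono
    Ioo_subset_Icc_self
  exact hf.comp contDiff_snd.contDiffOn fun p hp => hp.2

section LieGroup

variable {E : Type*} [NormedAddCommGroup E] [NormedSpace ℝ E] [CompleteSpace E]
  {F : Type*} [NormedAddCommGroup F] [NormedSpace ℝ F] [CompleteSpace F]
  {G : Type*} [TopologicalSpace G] [ChartedSpace E G] [Group G] [LieGroup 𝓘(ℝ, E) ∞ G]

/-- Local existence for the equation `γ⁻¹ γ' = R z`, `z' = q z` on `G × F`. -/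
theorem exists_curve_leftVelocity_eq (R : F →L[ℝ] E) {q : F → F} {W : Set F} (hW : IsOpen W)
    (hq : ContDiffOn ℝ ∞ q W) {U : Set G} (hU : IsOpen U) (h1U : (1 : G) ∈ U) {z₀ : F}
    (hz₀ : z₀ ∈ W) :
    ∃ ε : ℝ, 0 < ε ∧ ∃ (γ : ℝ → G) (z : ℝ → F), γ 0 = 1 ∧ z 0 = z₀ ∧
      ContMDiffOn 𝓘(ℝ, ℝ) 𝓘(ℝ, E) ∞ γ (Ioo (-ε) ε) ∧
      ∀ t ∈ Ioo (-ε) ε, γ t ∈ U ∧ z t ∈ W ∧ (leftVelocity γ t : E) = R (z t) ∧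
        HasDerivAt z (q (z t)) t := by
  have he : chartAt E (1 : G) ∈ IsManifold.maximalAtlas 𝓘(ℝ, E) ∞ G :=
    IsManifold.chart_mem_maximalAtlas 1
  set e := chartAt E (1 : G) with he_def
  have h1e : (1 : G) ∈ e.source := mem_chart_source E 1
  have hes : ContMDiffOn 𝓘(ℝ, E) 𝓘(ℝ, E) ∞ e e.source := contMDiffOn_of_mem_maximalAtlas he
  have hesymm : ContMDiffOn 𝓘(ℝ, E) 𝓘(ℝ, E) ∞ e.symm e.target :=
    contMDiffOn_symm_of_mem_maximalAtlas he
  -- `V a v` is the chart expression at `a` of the left invariant field generated by `v`, so the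
  -- equation on `G` becomes an ordinary differential equation on `E`.
  let V : E → E →L[ℝ] E := fun a => leftDeriv e (e.symm a)
  have hV : ContDiffOn ℝ ∞ V e.target :=
    ((contMDiffOn_leftDeriv e.open_source hes).comp hesymm fun a ha => e.map_target ha).contDiffOn
  have hT : IsOpen (e.target ∩ e.symm ⁻¹' U) := e.isOpen_inter_preimage_symm hU
  let f : E × F → E × F := fun p => (V p.1 (R p.2), q p.2)
  have hf : ContDiffOn ℝ ∞ f ((e.target ∩ e.symm ⁻¹' U) ×ˢ W) := by
    refine ContDiffOn.prodMk ?_ (hq.comp contDiff_snd.contDiffOn fun p hp => hp.2)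
    exact (hV.comp contDiff_fst.contDiffOn fun p hp => hp.1.1).clm_apply
      (R.contDiff.comp contDiff_snd).contDiffOn
  obtain ⟨ε, hε, α, hα0, hαs, hα⟩ := exists_contDiffOn_hasDerivAt_of_contDiffOn (hT.prod hW) hf
    (x₀ := (e 1, z₀)) ⟨⟨e.map_source h1e, by simpa [e.left_inv h1e] using h1U⟩, hz₀⟩
  refine ⟨ε, hε, fun t => e.symm (α t).1, fun t => (α t).2, ?_, ?_, ?_, fun t ht => ?_⟩
  · simp [hα0, e.left_inv h1e]
  · simp [hα0]
  · exact hesymm.comp (contDiff_fst.comp_contDiffOn hαs).contMDiffOn fun t ht => (hα t ht).1.1.1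
  · obtain ⟨⟨⟨ht1, htU⟩, htW⟩, hd⟩ := hα t ht
    have hd1 : HasDerivAt (fun t => (α t).1) (V (α t).1 (R (α t).2)) t :=
      (hasFDerivAt_fst (p := α t)).comp_hasDerivAt t hd
    refine ⟨htU, htW, leftVelocity_eq_of_mfderiv_eq ?_,
      (hasFDerivAt_snd (p := α t)).comp_hasDerivAt t hd⟩
    have h2 := (mdifferentiableAt_symm_of_mem_maximalAtlas he ht1).hasMFDerivAt.comp t
      hd1.hasFDerivAt.hasMFDerivAt
    refine (congrArg (fun L : ℝ →L[ℝ] E => L 1) h2.mfderiv).trans ?_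
    have h3 : (ContinuousLinearMap.toSpanSingleton ℝ (V (α t).1 (R (α t).2)) : ℝ →L[ℝ] E) 1 =
        V (α t).1 (R (α t).2) := by simp
    have h4 : V (α t).1 (R (α t).2) = (mfderiv 𝓘(ℝ, E) 𝓘(ℝ, E) e (e.symm (α t).1) : E →L[ℝ] E)
        (mulInvariantVectorField (I := 𝓘(ℝ, E)) (R (α t).2) (e.symm (α t).1)) :=
      leftDeriv_apply (mdifferentiableAt_of_mem_maximalAtlas he (e.map_target ht1)) _
    have h5 := (mdifferentiable_of_mem_maximalAtlas he).symm_comp_deriv (e.map_target ht1)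
    rw [e.right_inv ht1] at h5
    refine (congrArg (mfderiv 𝓘(ℝ, E) 𝓘(ℝ, E) e.symm (α t).1 : E →L[ℝ] E) (h3.trans h4)).trans ?_
    exact congrArg (fun L : E →L[ℝ] E => L
      (mulInvariantVectorField (I := 𝓘(ℝ, E)) (R (α t).2) (e.symm (α t).1))) h5

end LieGroup

end

end HomogeneousSpray

namespace HomogeneousSpray

noncomputable section

/-! ### The geodesic equation on the group, and its invariance -/

section InvariantSpray

variable {E : Type*} [NormedAddCommGroup E] [NormedSpace ℝ E]
  {F : Type*} [NormedAddCommGroup F] [NormedSpace ℝ F]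
  {G : Type*} [TopologicalSpace G] [ChartedSpace E G] [Group G]
  {H : Subgroup G} [ChartedSpace F (G ⧸ H)]
  {e : OpenPartialHomeomorph (G ⧸ H) F}

variable [LieGroup 𝓘(ℝ, E) ∞ G]

theorem velocity_mk_mem_slit_iff (hGH : IsSmoothCosetSpace E F H)
    (he : e ∈ IsManifold.maximalAtlas 𝓘(ℝ, F) ∞ (G ⧸ H)) {γ : ℝ → G} {t : ℝ}
    (hγ : MDifferentiableAt 𝓘(ℝ, ℝ) 𝓘(ℝ, E) γ t)
    (ht : (QuotientGroup.mk (γ t) : G ⧸ H) ∈ e.source) :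
    velocity (fun s => (QuotientGroup.mk (γ s) : G ⧸ H)) t ∈ slit F (G ⧸ H) ↔
      (leftDeriv (cosetChart e) (γ t) : E →L[ℝ] F) (leftVelocity γ t) ≠ 0 := by
  rw [← tangentChart_velocity_mk hGH he hγ ht, ne_eq, tangentChart_snd_eq_zero_iff he
    (p := velocity (fun s => (QuotientGroup.mk (γ s) : G ⧸ H)) t) ht]
  rfl

theorem velocity_smul (hGH : IsSmoothCosetSpace E F H) (g : G) {c : ℝ → G ⧸ H} {t : ℝ}
    (hc : MDifferentiableAt 𝓘(ℝ, ℝ) 𝓘(ℝ, F) c t) :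
    velocity (F := F) (fun s => g • c s) t = push g (velocity c t) := by
  have h := ((mdifferentiableAt_smul_coset hGH g (c t)).hasMFDerivAt.comp t hc.hasMFDerivAt).mfderiv
  exact congrArg (fun z : F => (⟨g • c t, z⟩ : TangentBundle 𝓘(ℝ, F) (G ⧸ H)))
    (congrArg (fun L : ℝ →L[ℝ] F => L 1) h)

variable [IsManifold 𝓘(ℝ, F) ∞ (G ⧸ H)]

/-- In the chart `e`, at the point `g • o`, the geodesic of `S` with initial velocity `g_* y` has a
lift `γ` with `d/dt (γ⁻¹ γ') = -v`. -/
def SprayEquation (S : Spray F (G ⧸ H)) (e : OpenPartialHomeomorph (G ⧸ H) F) (g : G) (y v : E) :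
    Prop :=
  (leftDeriv (leftDeriv (cosetChart e) : G → E →L[ℝ] F) g : E →L[ℝ] E →L[ℝ] F) y y
      - (leftDeriv (cosetChart e) g : E →L[ℝ] F) v
    = (-2 : ℝ) • coefficient S.toFun e (cosetChart e g) ((leftDeriv (cosetChart e) g : E →L[ℝ] F) y)


/-- The chart velocity of the projected curve is `A w`, where `w` is the left velocity. Its
derivative is `D(w, w) + A w'`, and the second order geodesic equation at time `t` turns into an
algebraic relation between `y` and `v`. -/
theorem hasMFDerivAt_velocity_mk_iff (hGH : IsSmoothCosetSpace E F H)
    (S : Spray F (G ⧸ H)) (he : e ∈ IsManifold.maximalAtlas 𝓘(ℝ, F) ∞ (G ⧸ H)) {γ : ℝ → G}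
    {J : Set ℝ} (hJ : IsOpen J) (hγ : ContMDiffOn 𝓘(ℝ, ℝ) 𝓘(ℝ, E) ∞ γ J) {t : ℝ} (ht : t ∈ J)
    (hte : (QuotientGroup.mk (γ t) : G ⧸ H) ∈ e.source) {y v : E}
    (hw : HasDerivAt (F := E) (fun s => leftVelocity γ s) (-v) t)
    (hy : (leftVelocity γ t : E) = y)
    (hy0 : (leftDeriv (cosetChart e) (γ t) : E →L[ℝ] F) y ≠ 0) :
    HasMFDerivAt 𝓘(ℝ, ℝ) 𝓘(ℝ, F).tangent
        (velocity (F := F) (fun s => (QuotientGroup.mk (γ s) : G ⧸ H))) t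
        ((1 : ℝ →L[ℝ] ℝ).smulRight
          (S.toFun (velocity (fun s => (QuotientGroup.mk (γ s) : G ⧸ H)) t))) ↔
      SprayEquation S e (γ t) y v := by
  subst hy
  have hγd : ∀ s ∈ J, MDifferentiableAt 𝓘(ℝ, ℝ) 𝓘(ℝ, E) γ s := fun s hs =>
    (hγ.contMDiffAt (hJ.mem_nhds hs)).mdifferentiableAt (by simp)
  have hslit := (velocity_mk_mem_slit_iff hGH he (hγd t ht) hte).2 hy0
  refine (hasMFDerivAt_velocity_iff S he (c := fun s => (QuotientGroup.mk (γ s) : G ⧸ H)) hJ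
    ((contMDiff_mk hGH).comp_contMDiffOn hγ) ht hslit hte).trans ?_
  have hev : (fun s => (tangentChart e (velocity (fun s => (QuotientGroup.mk (γ s) : G ⧸ H)) s)).2)
      =ᶠ[𝓝 t] fun s => (leftDeriv (cosetChart e) (γ s) : E →L[ℝ] F) (leftVelocity γ s) := by
    have hopen : γ ⁻¹' ((QuotientGroup.mk : G → G ⧸ H) ⁻¹' e.source) ∈ 𝓝 t :=
      (hγd t ht).continuousAt.preimage_mem_nhds ((isOpen_mk_preimage_source hGH).mem_nhds hte)
    filter_upwards [hJ.mem_nhds ht, hopen] with s hs hse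
    exact tangentChart_velocity_mk hGH he (hγd s hs) hse
  have hder := hasDerivAt_leftDeriv_apply (isOpen_mk_preimage_source hGH)
    (contMDiffOn_cosetChart hGH he) (hγd t ht) hte hw
  have hval : (tangentChart e (velocity (fun s => (QuotientGroup.mk (γ s) : G ⧸ H)) t)).2 =
      (leftDeriv (cosetChart e) (γ t) : E →L[ℝ] F) (leftVelocity γ t) := hev.self_of_nhds
  rw [hev.hasDerivAt_iff, hval]
  rw [map_neg, ← sub_eq_add_neg] at hder
  constructor
  · intro h
    exact hder.unique h
  · intro h
    have h' : _ - _ = _ := h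
    exact h' ▸ hder

/-- The velocity of `g • c` is `g_*` of that of `c`. The chain rule therefore applies the
differential of `g_*` to the spray, and invariance gives the spray at the new point. -/
theorem hasMFDerivAt_velocity_smul (hGH : IsSmoothCosetSpace E F H) {S : Spray F (G ⧸ H)}
    (hS : IsInvariant S) (g : G) {c : ℝ → G ⧸ H} {J : Set ℝ} (hJ : IsOpen J)
    (hc : ContMDiffOn 𝓘(ℝ, ℝ) 𝓘(ℝ, F) ∞ c J) {t : ℝ} (ht : t ∈ J)
    (hslit : velocity c t ∈ slit F (G ⧸ H))
    (h : HasMFDerivAt 𝓘(ℝ, ℝ) 𝓘(ℝ, F).tangent (velocity (F := F) c) t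
        ((1 : ℝ →L[ℝ] ℝ).smulRight (S.toFun (velocity c t)))) :
    HasMFDerivAt 𝓘(ℝ, ℝ) 𝓘(ℝ, F).tangent (velocity (F := F) (fun s => g • c s)) t
        ((1 : ℝ →L[ℝ] ℝ).smulRight (S.toFun (velocity (fun s => g • c s) t))) := by
  have hcd : ∀ s ∈ J, MDifferentiableAt 𝓘(ℝ, ℝ) 𝓘(ℝ, F) c s := fun s hs =>
    (hc.contMDiffAt (hJ.mem_nhds hs)).mdifferentiableAt (by simp)
  have hpush : MDifferentiableAt 𝓘(ℝ, F).tangent 𝓘(ℝ, F).tangent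
      (push g : TangentBundle 𝓘(ℝ, F) (G ⧸ H) → _) (velocity c t) :=
    ((contMDiff_smul_coset hGH g).contMDiff_tangentMap (m := ∞) le_rfl).mdifferentiable
      (by simp) _
  have h1 := hpush.hasMFDerivAt.comp t h
  have hev : velocity (F := F) (fun s => g • c s) =ᶠ[𝓝 t] push g ∘ velocity c := by
    filter_upwards [hJ.mem_nhds ht] with s hs
    exact velocity_smul hGH g (hcd s hs)
  have h2 := h1.congr_of_eventuallyEq hev
  have h3 := congrArg (fun q => (S.toFun q : F × F)) (velocity_smul hGH g (hcd t ht))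
  have h4 := hS g _ hslit
  have h5 : (mfderiv 𝓘(ℝ, F).tangent 𝓘(ℝ, F).tangent (push g) (velocity c t) :
      F × F →L[ℝ] F × F) (S.toFun (velocity c t)) =
      S.toFun (velocity (fun s => g • c s) t) := h4.trans h3.symm
  have h6 : ∀ (A : F × F →L[ℝ] F × F) (a b : F × F), A a = b →
      A.comp ((1 : ℝ →L[ℝ] ℝ).smulRight a) = (1 : ℝ →L[ℝ] ℝ).smulRight b := by
    rintro A a _ rfl
    ext <;> simp
  have h7 := h6 _ _ _ h5
  exact h7 ▸ h2

/-- By invariance of `S`, the equation `SprayEquation` holds at every point as soon as it holds at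
one point. -/
theorem SprayEquation.translate (hGH : IsSmoothCosetSpace E F H) {S : Spray F (G ⧸ H)}
    (hS : IsInvariant S) (he : e ∈ IsManifold.maximalAtlas 𝓘(ℝ, F) ∞ (G ⧸ H)) {γ : ℝ → G}
    {J : Set ℝ} (hJ : IsOpen J) (hγ : ContMDiffOn 𝓘(ℝ, ℝ) 𝓘(ℝ, E) ∞ γ J) {t : ℝ} (ht : t ∈ J)
    {y v : E} (hw : HasDerivAt (F := E) (fun s => leftVelocity γ s) (-v) t)
    (hy : (leftVelocity γ t : E) = y)
    (hslit : velocity (fun s => (QuotientGroup.mk (γ s) : G ⧸ H)) t ∈ slit F (G ⧸ H))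
    (h : HasMFDerivAt 𝓘(ℝ, ℝ) 𝓘(ℝ, F).tangent
        (velocity (F := F) (fun s => (QuotientGroup.mk (γ s) : G ⧸ H))) t
        ((1 : ℝ →L[ℝ] ℝ).smulRight
          (S.toFun (velocity (fun s => (QuotientGroup.mk (γ s) : G ⧸ H)) t))))
    (g : G) (hge : (QuotientGroup.mk (g * γ t) : G ⧸ H) ∈ e.source)
    (hy0 : (leftDeriv (cosetChart e) (g * γ t) : E →L[ℝ] F) y ≠ 0) :
    SprayEquation S e (g * γ t) y v := by
  have hγd : ∀ s ∈ J, MDifferentiableAt 𝓘(ℝ, ℝ) 𝓘(ℝ, E) γ s := fun s hs =>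
    (hγ.contMDiffAt (hJ.mem_nhds hs)).mdifferentiableAt (by simp)
  have hlv : ∀ s ∈ J, (leftVelocity (fun s => g * γ s) s : E) = leftVelocity γ s := fun s hs =>
    leftVelocity_mul_left g (hγd s hs)
  have h1 := hasMFDerivAt_velocity_smul hGH hS g hJ ((contMDiff_mk hGH).comp_contMDiffOn hγ) ht
    hslit h
  refine (hasMFDerivAt_velocity_mk_iff hGH S he hJ (γ := fun s => g * γ s)
    ((contMDiff_mul_left (a := g)).comp_contMDiffOn hγ) ht hge ?_ ((hlv t ht).trans hy) hy0).1 h1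
  refine hw.congr_of_eventuallyEq ?_
  filter_upwards [hJ.mem_nhds ht] with s hs using hlv s hs

end InvariantSpray

end

end HomogeneousSpray

namespace HomogeneousSpray

noncomputable section

theorem smul_origin {G : Type*} [Group G] {H : Subgroup G} (g : G) : g • origin H = QuotientGroup.mk g :=
  congrArg QuotientGroup.mk (mul_one g)

/-! ### Existence and differentiability of the spray vector field -/

section SprayVectorField

variable {E : Type*} [NormedAddCommGroup E] [NormedSpace ℝ E]
  {F : Type*} [NormedAddCommGroup F] [NormedSpace ℝ F]
  {G : Type*} [TopologicalSpace G] [ChartedSpace E G] [Group G]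
  {H : Subgroup G} [ChartedSpace F (G ⧸ H)]

theorem velocity_congr {M : Type*} [TopologicalSpace M] [ChartedSpace F M] {c c' : ℝ → M} {t : ℝ}
    (h : c =ᶠ[𝓝 t] c') : velocity (F := F) c t = velocity c' t := by
  have h1 : (mfderiv 𝓘(ℝ, ℝ) 𝓘(ℝ, F) c t : ℝ →L[ℝ] F) = mfderiv 𝓘(ℝ, ℝ) 𝓘(ℝ, F) c' t :=
    h.mfderiv_eq
  have key : ∀ (x x' : M) (a a' : F), x = x' → a = a' →
      (⟨x, a⟩ : TangentBundle 𝓘(ℝ, F) M) = ⟨x', a'⟩ := by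
    rintro x _ a _ rfl rfl
    rfl
  exact key _ _ _ _ h.self_of_nhds (congrArg (fun L : ℝ →L[ℝ] F => L 1) h1)

theorem eq_of_tangentChart_eq {M : Type*} [TopologicalSpace M] [ChartedSpace F M]
    {e : OpenPartialHomeomorph M F} (he : e ∈ IsManifold.maximalAtlas 𝓘(ℝ, F) ∞ M)
    {p q : TangentBundle 𝓘(ℝ, F) M} (hp : p.1 ∈ e.source) (hq : q.1 ∈ e.source)
    (h1 : e p.1 = e q.1) (h2 : (tangentChart e p).2 = (tangentChart e q).2) : p = q := by
  rw [← tangentChartSymm_tangentChart he hp, ← tangentChartSymm_tangentChart he hq, h2]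
  exact congrArg (fun x => tangentChartSymm e x (tangentChart e q).2) h1

theorem push_one (p : TangentBundle 𝓘(ℝ, F) (G ⧸ H)) : push (1 : G) p = p := by
  have h : (fun x : G ⧸ H => (1 : G) • x) = id := funext fun x => one_smul G x
  rw [push, h, tangentMap_id]
  rfl

variable [LieGroup 𝓘(ℝ, E) ∞ G] [IsManifold 𝓘(ℝ, F) ∞ (G ⧸ H)]

/-- `IsSprayVector` implies the equation in a chart around the origin. -/
theorem IsSprayVector.sprayEquation (hGH : IsSmoothCosetSpace E F H) {S : Spray F (G ⧸ H)}
    {e : OpenPartialHomeomorph (G ⧸ H) F} (he : e ∈ IsManifold.maximalAtlas 𝓘(ℝ, F) ∞ (G ⧸ H))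
    (h1e : (QuotientGroup.mk 1 : G ⧸ H) ∈ e.source)
    {m : Submodule ℝ (GroupLieAlgebra 𝓘(ℝ, E) G)} (hm : IsCompl (subgroupLieAlgebra E H) m)
    {y v : m} (hy : y ≠ 0) (h : IsSprayVector S m y v) :
    SprayEquation (E := E) S e 1 (y : GroupLieAlgebra 𝓘(ℝ, E) G) (v : GroupLieAlgebra 𝓘(ℝ, E) G) := by
  obtain ⟨ε, hε, c, γ, hgeo, hc0, hv0, hlift, hder⟩ := h
  have h0 : (0 : ℝ) ∈ Ioo (-ε) ε := by simp [hε]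
  have hmem : Ioo (-ε) ε ∈ 𝓝 (0 : ℝ) := isOpen_Ioo.mem_nhds h0
  have hγ0 := hlift.zero
  have hcγ : ∀ s ∈ Ioo (-ε) ε, c s = QuotientGroup.mk (γ s) := fun s hs =>
    (hlift.proj s hs).trans (smul_origin _)
  have hvel : ∀ s ∈ Ioo (-ε) ε,
      velocity (F := F) c s = velocity (fun s => (QuotientGroup.mk (γ s) : G ⧸ H)) s :=
    fun s hs => velocity_congr <| by
      filter_upwards [isOpen_Ioo.mem_nhds hs] with r hr using hcγ r hr
  have hγd : MDifferentiableAt 𝓘(ℝ, ℝ) 𝓘(ℝ, E) γ 0 :=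
    (hlift.smooth.contMDiffAt hmem).mdifferentiableAt (by simp)
  have h0e : (QuotientGroup.mk (γ 0) : G ⧸ H) ∈ e.source := by rw [hγ0]; exact h1e
  have hA : (leftDeriv (cosetChart e) (1 : G) : E →L[ℝ] F) (leftVelocity γ 0) =
      (leftDeriv (cosetChart e) (1 : G) : E →L[ℝ] F) (y : GroupLieAlgebra 𝓘(ℝ, E) G) := by
    have h1 := tangentChart_velocity_mk hGH he hγd h0e
    rw [← hvel 0 h0, hv0, ← push_one (toOrigin H _), tangentChart_push_toOrigin hGH he h1e] at h1
    have h2 : (leftDeriv (cosetChart e) (γ 0) : E →L[ℝ] F) = leftDeriv (cosetChart e) 1 := by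
      rw [hγ0]
    rw [h1, h2]
  -- The initial left velocity and `y` project to the same vector at the origin. Their difference
  -- lies in both `𝔥` and `𝔪`, hence vanishes.
  have hsub : ((leftVelocity γ 0 : GroupLieAlgebra 𝓘(ℝ, E) G) - y) ∈ subgroupLieAlgebra E H := by
    refine (leftDeriv_cosetChart_eq_zero_iff hGH he h1e _).1 ?_
    exact (map_sub (leftDeriv (cosetChart e) (1 : G) : E →L[ℝ] F) _ _).trans (sub_eq_zero.2 hA)
  have hy' : (leftVelocity γ 0 : GroupLieAlgebra 𝓘(ℝ, E) G) = y :=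
    sub_eq_zero.1 (Submodule.disjoint_def.1 hm.disjoint _ hsub
      (m.sub_mem (hlift.mem 0 h0) y.2))
  have hy0 : ∀ g, g = (1 : G) →
      (leftDeriv (cosetChart e) g : E →L[ℝ] F) (y : GroupLieAlgebra 𝓘(ℝ, E) G) ≠ 0 := by
    rintro _ rfl h
    exact hy (Subtype.ext (Submodule.disjoint_def.1 hm.disjoint _
      ((leftDeriv_cosetChart_eq_zero_iff hGH he h1e _).1 h) y.2))
  have hint := (hgeo.integral 0 h0).hasMFDerivAt hmem
  have hint' := hint.congr_of_eventuallyEq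
    (f₁ := velocity (fun s => (QuotientGroup.mk (γ s) : G ⧸ H)))
    (by filter_upwards [hmem] with s hs using (hvel s hs).symm)
  have hS : (S.toFun (velocity c 0) : F × F) =
      S.toFun (velocity (fun s => (QuotientGroup.mk (γ s) : G ⧸ H)) 0) :=
    congrArg (fun q => (S.toFun q : F × F)) (hvel 0 h0)
  have h7 := (hasMFDerivAt_velocity_mk_iff hGH S he isOpen_Ioo hlift.smooth h0 h0e
    (y := (y : GroupLieAlgebra 𝓘(ℝ, E) G)) (v := (v : GroupLieAlgebra 𝓘(ℝ, E) G)) hder hy'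
    (hy0 _ hγ0)).1 (by
      have h8 : ∀ a b : F × F, a = b →
        (1 : ℝ →L[ℝ] ℝ).smulRight a = (1 : ℝ →L[ℝ] ℝ).smulRight b := by
          rintro a _ rfl
          rfl
      exact (h8 _ _ hS) ▸ hint')
  rwa [hγ0] at h7

variable [FiniteDimensional ℝ E] [FiniteDimensional ℝ F]

/-- Solving the spray equation at `1` for `v ∈ 𝔪` gives the explicit formula `η = R ∘ q ∘ A`,
differentiable at nonzero vectors of `𝔪` because `A` does not vanish there. Defining it on all of
`E` makes the Fréchet derivative available. The remaining work is to show that the equation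
propagates to every `g`, and that geodesics with lifts exist so that `sprayVectorField` is not its
default value. -/
theorem exists_sprayVectorField_eq (hGH : IsSmoothCosetSpace E F H) {S : Spray F (G ⧸ H)}
    (hS : IsInvariant S)
    {m : Submodule ℝ (GroupLieAlgebra 𝓘(ℝ, E) G)} (hm : IsCompl (subgroupLieAlgebra E H) m) :
    ∃ η : E → E, (∀ y : m, y ≠ 0 →
        (sprayVectorField S m y : GroupLieAlgebra 𝓘(ℝ, E) G) =
          η (y : GroupLieAlgebra 𝓘(ℝ, E) G)) ∧
      ∀ y ∈ m, y ≠ 0 → DifferentiableAt ℝ (E := E) (F := E) η y ∧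
        ∀ e ∈ IsManifold.maximalAtlas 𝓘(ℝ, F) ∞ (G ⧸ H), ∀ g : G,
          (QuotientGroup.mk g : G ⧸ H) ∈ e.source →
          SprayEquation (E := E) S e g y (η y) := by
  have : CompleteSpace E := FiniteDimensional.complete ℝ E
  have : CompleteSpace F := FiniteDimensional.complete ℝ F
  set e := chartAt F (QuotientGroup.mk 1 : G ⧸ H) with he_def
  have he : e ∈ IsManifold.maximalAtlas 𝓘(ℝ, F) ∞ (G ⧸ H) := IsManifold.chart_mem_maximalAtlas _
  have h1e : (QuotientGroup.mk 1 : G ⧸ H) ∈ e.source := mem_chart_source F _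
  have hne : ∀ e ∈ IsManifold.maximalAtlas 𝓘(ℝ, F) ∞ (G ⧸ H), ∀ g : G,
      (QuotientGroup.mk g : G ⧸ H) ∈ e.source → ∀ y ∈ m, y ≠ 0 →
      (leftDeriv (cosetChart e) g : E →L[ℝ] F) y ≠ 0 := fun e he g hg y hy hy0 h =>
    hy0 (Submodule.disjoint_def.1 hm.disjoint _
      ((leftDeriv_cosetChart_eq_zero_iff hGH he hg _).1 h) hy)
  obtain ⟨R, hRm, hAR, hRA⟩ := exists_rightInverse_leftDeriv_cosetChart hGH he h1e hm
  set A : E →L[ℝ] F := leftDeriv (cosetChart e) 1 with hA_def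
  set D : E →L[ℝ] E →L[ℝ] F := leftDeriv (leftDeriv (cosetChart e) : G → E →L[ℝ] F) 1 with hD_def
  -- The value of `A v` forced by the spray equation at `1` for the vector `y = R z`.
  let q : F → F := fun z => D (R z) (R z) + (2 : ℝ) • coefficient S.toFun e (cosetChart e 1) z
  have hq : ContDiffOn ℝ ∞ q {0}ᶜ := by
    refine ContDiffOn.add ?_ ((contDiffOn_coefficient S he (e.map_source h1e)).const_smul _)
    exact (ContDiff.clm_apply (D.contDiff.comp R.contDiff) R.contDiff).contDiffOn
  have hR0 : ∀ z, z ≠ 0 → (R z : GroupLieAlgebra 𝓘(ℝ, E) G) ≠ 0 := fun z hz h => by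
    have h2 : A (R z) = A 0 := congrArg A h
    rw [hAR, map_zero] at h2
    exact hz h2
  have hspray1 : ∀ z, SprayEquation S e (1 : G) (R z) (R (q z)) := by
    intro z
    change D (R z) (R z) - A (R (q z)) = (-2 : ℝ) • coefficient S.toFun e (cosetChart e 1) (A (R z))
    rw [hAR, hAR]
    simp only [q, neg_smul]
    abel
  -- The system `γ⁻¹ γ' = R z`, `z' = -q z` is the expected geodesic flow, reduced by the group to a
  -- fixed equation for `z`.
  have hcurve := fun z₀ (hz₀ : z₀ ∈ ({0}ᶜ : Set F)) => exists_curve_leftVelocity_eq (G := G) R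
    isOpen_compl_singleton hq.neg (isOpen_mk_preimage_source hGH (e := e)) h1e hz₀
  have hder : ∀ {γ : ℝ → G} {z : ℝ → F} {J : Set ℝ}, IsOpen J →
      (∀ t ∈ J, (leftVelocity γ t : E) = R (z t) ∧ HasDerivAt z (-q (z t)) t) →
      ∀ t ∈ J, HasDerivAt (F := E) (fun s => leftVelocity γ s) (-(R (q (z t)))) t := by
    intro γ z J hJ h t ht
    have h1 : HasDerivAt (fun s => R (z s)) (R (-q (z t))) t :=
      R.hasFDerivAt.comp_hasDerivAt t (h t ht).2
    rw [map_neg] at h1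
    refine h1.congr_of_eventuallyEq ?_
    filter_upwards [hJ.mem_nhds ht] with s hs using (h s hs).1
  -- The curve from `1` with initial value `z₀` satisfies the geodesic equation at time `0` by the
  -- choice of `q`. Translating it by `g` yields the equation at `g`, in any chart.
  have hspray : ∀ z₀, z₀ ≠ 0 → ∀ e' ∈ IsManifold.maximalAtlas 𝓘(ℝ, F) ∞ (G ⧸ H), ∀ g : G,
      (QuotientGroup.mk g : G ⧸ H) ∈ e'.source → SprayEquation S e' g (R z₀) (R (q z₀)) := by
    intro z₀ hz₀ e' he' g hg
    obtain ⟨ε, hε, γ, z, hγ0, hz0, hγ, h⟩ := hcurve z₀ hz₀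
    have h0 : (0 : ℝ) ∈ Ioo (-ε) ε := by simp [hε]
    have hd := hder isOpen_Ioo (fun t ht => (h t ht).2.2) 0 h0
    have hlv : (leftVelocity γ 0 : E) = R z₀ := by rw [← hz0]; exact (h 0 h0).2.2.1
    rw [hz0] at hd
    have h0e : (QuotientGroup.mk (γ 0) : G ⧸ H) ∈ e.source := (h 0 h0).1
    have hAne : (leftDeriv (cosetChart e) (γ 0) : E →L[ℝ] F) (R z₀) ≠ 0 :=
      hne e he _ h0e _ (hRm z₀) (hR0 z₀ hz₀)
    have hvd := (hasMFDerivAt_velocity_mk_iff hGH S he isOpen_Ioo hγ h0 h0e hd hlv hAne).2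
      (by rw [hγ0]; exact hspray1 z₀)
    have hγd : MDifferentiableAt 𝓘(ℝ, ℝ) 𝓘(ℝ, E) γ 0 :=
      (hγ.contMDiffAt (isOpen_Ioo.mem_nhds h0)).mdifferentiableAt (by simp)
    have hslit := (velocity_mk_mem_slit_iff hGH he hγd h0e).2 (by
      have h9 : ∀ a : E, a = R z₀ → (leftDeriv (cosetChart e) (γ 0) : E →L[ℝ] F) a ≠ 0 := by
        rintro _ rfl
        exact hAne
      exact h9 _ hlv)
    have hg' : g * γ 0 = g := by rw [hγ0, mul_one]
    have := SprayEquation.translate hGH hS he' isOpen_Ioo hγ h0 hd hlv hslit hvd g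
      (by rw [hg']; exact hg) (by rw [hg']; exact hne e' he' g hg _ (hRm z₀) (hR0 z₀ hz₀))
    rwa [hg'] at this
  have hAne : ∀ y ∈ m, y ≠ 0 → A y ≠ 0 := hne e he 1 h1e
  refine ⟨fun y => R (q (A y)), ?_, fun y hy hy0 => ⟨?_, ?_⟩⟩
  · intro y hy
    have hy' : (y : GroupLieAlgebra 𝓘(ℝ, E) G) ≠ 0 := fun h => hy (Subtype.ext h)
    have hex : ∃ v, IsSprayVector S m y v := by
      obtain ⟨ε, hε, γ, z, hγ0, hz0, hγ, h⟩ := hcurve (A (y : GroupLieAlgebra 𝓘(ℝ, E) G))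
        (hAne _ y.2 hy')
      have h0 : (0 : ℝ) ∈ Ioo (-ε) ε := by simp [hε]
      have hd := hder isOpen_Ioo (fun t ht => (h t ht).2.2)
      have hγd : ∀ t ∈ Ioo (-ε) ε, MDifferentiableAt 𝓘(ℝ, ℝ) 𝓘(ℝ, E) γ t := fun t ht =>
        (hγ.contMDiffAt (isOpen_Ioo.mem_nhds ht)).mdifferentiableAt (by simp)
      have hlvm : ∀ t ∈ Ioo (-ε) ε, leftVelocity γ t ∈ m := by
        intro t ht
        have h1 := hRm (z t)
        rwa [← (h t ht).2.2.1] at h1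
      have hlv0 : ∀ t ∈ Ioo (-ε) ε, leftVelocity γ t ≠ (0 : GroupLieAlgebra 𝓘(ℝ, E) G) := by
        intro t ht
        have h1 := hR0 (z t) (h t ht).2.1
        rwa [← (h t ht).2.2.1] at h1
      have hslit : ∀ t ∈ Ioo (-ε) ε,
          velocity (fun s => (QuotientGroup.mk (γ s) : G ⧸ H)) t ∈ slit F (G ⧸ H) := fun t ht =>
        (velocity_mk_mem_slit_iff hGH he (hγd t ht) (h t ht).1).2
          (hne e he _ (h t ht).1 _ (hlvm t ht) (hlv0 t ht))
      refine ⟨⟨R (q (A (y : GroupLieAlgebra 𝓘(ℝ, E) G))), hRm _⟩, ε, hε,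
        fun s => QuotientGroup.mk (γ s), γ, ⟨(contMDiff_mk hGH).comp_contMDiffOn hγ, hslit, ?_⟩,
        congrArg QuotientGroup.mk hγ0, ?_, ⟨hγ, hγ0, fun t _ => (smul_origin (γ t)).symm, hlvm, hlv0⟩,
        ?_⟩
      · intro t ht
        refine HasMFDerivAt.hasMFDerivWithinAt ?_
        refine (hasMFDerivAt_velocity_mk_iff hGH S he isOpen_Ioo hγ ht (h t ht).1 (hd t ht)
          (h t ht).2.2.1 (hne e he _ (h t ht).1 _ (hRm _) (hR0 _ (h t ht).2.1))).2 ?_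
        -- At a later time the equation is needed at `γ t` for `R (z t)`, which is the propagated
        -- equation with `g = γ t`. Hence the solution is a geodesic on its whole interval.
        exact hspray (z t) (h t ht).2.1 e he (γ t) (h t ht).1
      · have h0e : (QuotientGroup.mk (γ 0) : G ⧸ H) ∈ e.source := (h 0 h0).1
        refine eq_of_tangentChart_eq he h0e h1e (congrArg (fun g => cosetChart e g) hγ0) ?_
        rw [tangentChart_velocity_mk hGH he (hγd 0 h0) h0e, ← push_one (toOrigin H _),
          tangentChart_push_toOrigin hGH he h1e]
        have h1 : (leftVelocity γ 0 : E) = (y : GroupLieAlgebra 𝓘(ℝ, E) G) := by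
          rw [(h 0 h0).2.2.1, hz0]
          exact hRA _ y.2
        have h2 : (leftDeriv (cosetChart e) (γ 0) : E →L[ℝ] F) = A := by rw [hγ0]
        exact congrArg₂ (fun (L : E →L[ℝ] F) (a : E) => L a) h2 h1
      · have h1 := hd 0 h0
        rw [hz0] at h1
        exact h1
    have hch : sprayVectorField S m y = hex.choose := by
      rw [sprayVectorField, dif_pos hex]
    -- Every admissible value solves the equation at `1`, and `A` is injective on `𝔪`. The choice in
    -- the definition is therefore harmless and no uniqueness of geodesics is required.
    have heq := IsSprayVector.sprayEquation hGH he h1e hm hy (hch ▸ hex.choose_spec)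
    have h1 : D _ _ - A (sprayVectorField S m y : GroupLieAlgebra 𝓘(ℝ, E) G) = _ := heq
    have h2 : A (sprayVectorField S m y : GroupLieAlgebra 𝓘(ℝ, E) G) =
        q (A (y : GroupLieAlgebra 𝓘(ℝ, E) G)) := by
      have h3 : R (A (y : GroupLieAlgebra 𝓘(ℝ, E) G)) = (y : GroupLieAlgebra 𝓘(ℝ, E) G) :=
        hRA _ y.2
      have h4 : ∀ a b c : F, a - b = (-2 : ℝ) • c → b = a + (2 : ℝ) • c := by
        intro a b c h
        rw [neg_smul, sub_eq_iff_eq_add] at h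
        rw [h]
        abel
      refine (h4 _ _ _ h1).trans ?_
      change _ = D (R (A _)) (R (A _)) + _
      rw [h3]
    exact (hRA _ (sprayVectorField S m y).2).symm.trans (congrArg R h2)
  · have h1 : DifferentiableAt ℝ q (A y) :=
      (hq.contDiffAt (isOpen_compl_singleton.mem_nhds (hAne y hy hy0))).differentiableAt (by simp)
    exact R.differentiableAt.comp (E := E) y (h1.comp (E := E) y A.differentiableAt)
  · have h1 := hspray (A y) (hAne y hy hy0)
    rwa [show R (A y) = y from hRA y hy] at h1

end SprayVectorField

end

end HomogeneousSpray

namespace HomogeneousSpray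

noncomputable section

/-- A linear left inverse of the inclusion, continuous in finite dimension, transfers
differentiability from `E` to `m`. -/
theorem coe_deriv_eq_of_hasDerivAt {E : Type*} [NormedAddCommGroup E] [NormedSpace ℝ E]
    [FiniteDimensional ℝ E] (m : Submodule ℝ E) {p : ℝ → m} {d : E} {t : ℝ}
    (h : HasDerivAt (fun s => (p s : E)) d t) : ((deriv p t : m) : E) = d := by
  obtain ⟨P, hP⟩ := m.subtype.exists_leftInverse_of_injective m.ker_subtype
  have hP' : ∀ x : m, P (x : E) = x := fun x => congrArg (fun L : m →ₗ[ℝ] m => L x) hP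
  have h1 : HasDerivAt (fun s => P.toContinuousLinearMap (p s : E)) (P.toContinuousLinearMap d) t :=
    P.toContinuousLinearMap.hasFDerivAt.comp_hasDerivAt t h
  have h2 : HasDerivAt p (P.toContinuousLinearMap d) t :=
    h1.congr_of_eventuallyEq (Filter.Eventually.of_forall fun s => (hP' (p s)).symm)
  have h3 : HasDerivAt (fun s => (p s : E)) (deriv p t : m) t :=
    m.subtypeL.hasFDerivAt.comp_hasDerivAt t h2.differentiableAt.hasDerivAt
  exact h3.unique h

/-- If `A s (y s)` is differentiable and `A t` is injective on a subspace containing the values of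
`y`, then `y` is differentiable. -/
theorem differentiableAt_of_clm_apply {E F : Type*} [NormedAddCommGroup E] [NormedSpace ℝ E]
    [NormedAddCommGroup F] [NormedSpace ℝ F] [CompleteSpace F] {A : ℝ → E →L[ℝ] F} {y : ℝ → E}
    {t : ℝ} (hA : DifferentiableAt ℝ A t) (hAy : DifferentiableAt ℝ (fun s => A s (y s)) t)
    {R : F →L[ℝ] E} (hAR : ∀ z, A t (R z) = z) (hRA : ∀ᶠ s in 𝓝 t, R (A t (y s)) = y s) :
    DifferentiableAt ℝ y t := by
  -- `T` is the identity at time `t`, hence invertible nearby, and `y = R (T⁻¹ (A y))` shows `y` as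
  -- a composite of differentiable maps.
  let T : ℝ → F →L[ℝ] F := fun s => (A s).comp R
  have hT : DifferentiableAt ℝ T t := hA.clm_comp (differentiableAt_const R)
  have hT1 : T t = 1 := ContinuousLinearMap.ext hAR
  have hunit : ∀ᶠ s in 𝓝 t, IsUnit (T s) :=
    hT.continuousAt.eventually_mem (Units.isOpen.mem_nhds (by rw [mem_ofPred_eq, hT1]; exact isUnit_one))
  have hinv : DifferentiableAt ℝ (fun s => Ring.inverse (T s)) t := by
    have h1 : DifferentiableAt ℝ (Ring.inverse : (F →L[ℝ] F) → F →L[ℝ] F) (T t) := by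
      rw [hT1]
      exact differentiableAt_inverse isUnit_one
    exact h1.comp t hT
  have h2 : DifferentiableAt ℝ (fun s => R (Ring.inverse (T s) (A s (y s)))) t :=
    R.differentiableAt.comp t (hinv.clm_apply hAy)
  refine h2.congr_of_eventuallyEq ?_
  filter_upwards [hunit, hRA] with s hs hsR
  have h3 : A s (y s) = T s (A t (y s)) := by
    change _ = A s (R (A t (y s)))
    rw [hsR]
  rw [h3, ← mul_apply_eq_comp, Ring.inverse_mul_cancel _ hs,
    one_apply_eq_self, hsR]

/-! ### Connection coefficients and the connection operator -/

section Main

variable {E : Type*} [NormedAddCommGroup E] [NormedSpace ℝ E]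
  {F : Type*} [NormedAddCommGroup F] [NormedSpace ℝ F]
  {G : Type*} [TopologicalSpace G] [ChartedSpace E G] [Group G]
  {H : Subgroup G} [ChartedSpace F (G ⧸ H)] [IsManifold 𝓘(ℝ, F) ∞ (G ⧸ H)]
  {e : OpenPartialHomeomorph (G ⧸ H) F}

/-- The connection coefficients, obtained by polarizing the equation of the spray. -/
theorem connectionCoefficient_leftDeriv {S : Spray F (G ⧸ H)} (he : e ∈ IsManifold.maximalAtlas 𝓘(ℝ, F) ∞ (G ⧸ H)) {g : G}
    (hge : (QuotientGroup.mk g : G ⧸ H) ∈ e.source) {η : E → E} {y u : E}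
    (hη : DifferentiableAt ℝ η y)
    (hy : (leftDeriv (cosetChart e) g : E →L[ℝ] F) y ≠ 0)
    (h : ∀ᶠ s in 𝓝 (0 : ℝ), SprayEquation S e g (y + s • u) (η (y + s • u))) :
    connectionCoefficient S e (cosetChart e g) ((leftDeriv (cosetChart e) g : E →L[ℝ] F) y)
        ((leftDeriv (cosetChart e) g : E →L[ℝ] F) u) =
      -(1 / 2 : ℝ) •
        ((leftDeriv (leftDeriv (cosetChart e) : G → E →L[ℝ] F) g : E →L[ℝ] E →L[ℝ] F) u y +
          (leftDeriv (leftDeriv (cosetChart e) : G → E →L[ℝ] F) g : E →L[ℝ] E →L[ℝ] F) y u -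
          (leftDeriv (cosetChart e) g : E →L[ℝ] F) (fderiv ℝ η y u)) := by
  set A : E →L[ℝ] F := leftDeriv (cosetChart e) g
  set D : E →L[ℝ] E →L[ℝ] F := leftDeriv (leftDeriv (cosetChart e) : G → E →L[ℝ] F) g
  have hline : HasDerivAt (fun s : ℝ => y + s • u) u 0 := by
    simpa using ((hasDerivAt_id (0 : ℝ)).smul_const u).const_add y
  have hy0 : y + (0 : ℝ) • u = y := by simp
  have hG : DifferentiableAt ℝ (fun z => coefficient S.toFun e (cosetChart e g) z) (A y) :=
    ((contDiffOn_coefficient S he (e.map_source hge)).contDiffAt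
      (isOpen_compl_singleton.mem_nhds hy)).differentiableAt (by simp)
  have h1 : HasDerivAt (fun s : ℝ => coefficient S.toFun e (cosetChart e g) (A (y + s • u)))
      (connectionCoefficient S e (cosetChart e g) (A y) (A u)) 0 := by
    have h2 : HasFDerivAt (fun z => coefficient S.toFun e (cosetChart e g) z)
        (connectionCoefficient S e (cosetChart e g) (A y)) (A (y + (0 : ℝ) • u)) := by
      rw [hy0]
      exact hG.hasFDerivAt
    exact HasFDerivAt.comp_hasDerivAt (l := fun z => coefficient S.toFun e (cosetChart e g) z)
      (f := fun s : ℝ => A (y + s • u)) (0 : ℝ) h2 (A.hasFDerivAt.comp_hasDerivAt (0 : ℝ) hline)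
  have h3 : HasDerivAt (fun s : ℝ => η (y + s • u)) (fderiv ℝ η y u) 0 := by
    have h4 : HasFDerivAt η (fderiv ℝ η y) (y + (0 : ℝ) • u) := by
      rw [hy0]
      exact hη.hasFDerivAt
    exact h4.comp_hasDerivAt (0 : ℝ) hline
  -- The spray equation expresses the coefficient along the line `y + s u` through the quadratic
  -- form `D` and `η`. Its derivative at `s = 0` is the polarization.
  have h5 : HasDerivAt (fun s : ℝ => -(1 / 2 : ℝ) •
      (D (y + s • u) (y + s • u) - A (η (y + s • u))))
      (-(1 / 2 : ℝ) • (D u y + D y u - A (fderiv ℝ η y u))) 0 := by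
    have h6 := (D.hasFDerivAt.comp_hasDerivAt (0 : ℝ) hline).clm_apply hline
    have h7 := A.hasFDerivAt.comp_hasDerivAt (0 : ℝ) h3
    have h8 := (h6.sub h7).const_smul (-(1 / 2 : ℝ))
    simp only [Function.comp, hy0] at h8
    exact h8
  refine h1.unique (h5.congr_of_eventuallyEq ?_)
  filter_upwards [h] with s hs
  have hs' : D (y + s • u) (y + s • u) - A (η (y + s • u)) = _ := hs
  rw [hs', smul_smul]
  norm_num
  rfl

variable [LieGroup 𝓘(ℝ, E) ∞ G] [FiniteDimensional ℝ E]

/-- `A` does not see the `𝔥`-part of the bracket, so the projection to `𝔪` can be dropped. What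
remains, `A [y, u]`, is the antisymmetric part of `D`, ready to meet the symmetric part in the
connection coefficients. -/
theorem leftDeriv_connectionOperator (hGH : IsSmoothCosetSpace E F H)
    {S : Spray F (G ⧸ H)} {m : Submodule ℝ (GroupLieAlgebra 𝓘(ℝ, E) G)}
    (hm : IsCompl (subgroupLieAlgebra E H) m)
    (he : e ∈ IsManifold.maximalAtlas 𝓘(ℝ, F) ∞ (G ⧸ H)) {g : G}
    (hge : (QuotientGroup.mk g : G ⧸ H) ∈ e.source) {η : E → E} {y : m} (hy : y ≠ 0) (u : m)
    (hη : DifferentiableAt ℝ (E := E) (F := E) η (y : GroupLieAlgebra 𝓘(ℝ, E) G))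
    (hη' : ∀ y : m, y ≠ 0 → (sprayVectorField S m y : GroupLieAlgebra 𝓘(ℝ, E) G) =
      η (y : GroupLieAlgebra 𝓘(ℝ, E) G)) :
    (leftDeriv (cosetChart e) g : E →L[ℝ] F)
        (connectionOperator S m hm y u : GroupLieAlgebra 𝓘(ℝ, E) G) =
      (1 / 2 : ℝ) • (leftDeriv (cosetChart e) g : E →L[ℝ] F)
          (fderiv ℝ (E := E) (F := E) η (y : GroupLieAlgebra 𝓘(ℝ, E) G)
            (u : GroupLieAlgebra 𝓘(ℝ, E) G)) -
        (1 / 2 : ℝ) •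
          ((leftDeriv (leftDeriv (cosetChart e) : G → E →L[ℝ] F) g : E →L[ℝ] E →L[ℝ] F)
              (y : GroupLieAlgebra 𝓘(ℝ, E) G) (u : GroupLieAlgebra 𝓘(ℝ, E) G) -
            (leftDeriv (leftDeriv (cosetChart e) : G → E →L[ℝ] F) g : E →L[ℝ] E →L[ℝ] F)
              (u : GroupLieAlgebra 𝓘(ℝ, E) G) (y : GroupLieAlgebra 𝓘(ℝ, E) G)) := by
  have : CompleteSpace E := FiniteDimensional.complete ℝ E
  set A : E →L[ℝ] F := leftDeriv (cosetChart e) g with hA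
  have hbr := leftDeriv_leftDeriv_sub (isOpen_mk_preimage_source hGH)
    (contMDiffOn_cosetChart hGH he) (g := g) hge (y : GroupLieAlgebra 𝓘(ℝ, E) G)
    (u : GroupLieAlgebra 𝓘(ℝ, E) G)
  rw [hbr]
  have hproj : A (m.projectionOnto (subgroupLieAlgebra E H) hm.symm
      ⁅(y : GroupLieAlgebra 𝓘(ℝ, E) G), (u : GroupLieAlgebra 𝓘(ℝ, E) G)⁆ :
        GroupLieAlgebra 𝓘(ℝ, E) G) =
      A (⁅(y : GroupLieAlgebra 𝓘(ℝ, E) G), (u : GroupLieAlgebra 𝓘(ℝ, E) G)⁆ :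
        GroupLieAlgebra 𝓘(ℝ, E) G) := by
    have hker : (⁅(y : GroupLieAlgebra 𝓘(ℝ, E) G), (u : GroupLieAlgebra 𝓘(ℝ, E) G)⁆ -
        (m.projectionOnto (subgroupLieAlgebra E H) hm.symm
          ⁅(y : GroupLieAlgebra 𝓘(ℝ, E) G), (u : GroupLieAlgebra 𝓘(ℝ, E) G)⁆ :
            GroupLieAlgebra 𝓘(ℝ, E) G)) ∈ subgroupLieAlgebra E H := by
      rw [← Submodule.projectionOnto_apply_eq_zero_iff hm.symm, map_sub,
        Submodule.projectionOnto_apply_left, sub_self]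
    have h0 := (leftDeriv_cosetChart_eq_zero_iff hGH he hge _).2 hker
    exact (sub_eq_zero.1 ((map_sub A _ _).symm.trans h0)).symm
  have hder : ((deriv (fun t : ℝ => sprayVectorField S m (y + t • u)) 0 : m) :
      GroupLieAlgebra 𝓘(ℝ, E) G) =
      fderiv ℝ (E := E) (F := E) η (y : GroupLieAlgebra 𝓘(ℝ, E) G)
            (u : GroupLieAlgebra 𝓘(ℝ, E) G) := by
    refine coe_deriv_eq_of_hasDerivAt (E := E) m ?_
    let y' : E := (y : GroupLieAlgebra 𝓘(ℝ, E) G)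
    let u' : E := (u : GroupLieAlgebra 𝓘(ℝ, E) G)
    have hline : HasDerivAt (fun t : ℝ => y' + t • u') u' 0 := by
      simpa using ((hasDerivAt_id (0 : ℝ)).smul_const u').const_add y'
    have hη0 : HasFDerivAt η (fderiv ℝ η y') (y' + (0 : ℝ) • u') := by
      rw [zero_smul, add_zero]
      exact hη.hasFDerivAt
    refine (hη0.comp_hasDerivAt (0 : ℝ) hline).congr_of_eventuallyEq ?_
    have hne : ∀ᶠ t : ℝ in 𝓝 0, y' + t • u' ≠ 0 := by
      refine hline.continuousAt.eventually_ne ?_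
      rw [zero_smul, add_zero]
      exact fun h => hy (Subtype.ext h)
    filter_upwards [hne] with t ht
    exact hη' (y + t • u) fun h => ht (congrArg Subtype.val h)
  have hco : (connectionOperator S m hm y u : GroupLieAlgebra 𝓘(ℝ, E) G) =
      (1 / 2 : ℝ) • ((deriv (fun t : ℝ => sprayVectorField S m (y + t • u)) 0 : m) :
          GroupLieAlgebra 𝓘(ℝ, E) G) -
        (1 / 2 : ℝ) • (m.projectionOnto (subgroupLieAlgebra E H) hm.symm
          ⁅(y : GroupLieAlgebra 𝓘(ℝ, E) G), (u : GroupLieAlgebra 𝓘(ℝ, E) G)⁆ :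
            GroupLieAlgebra 𝓘(ℝ, E) G) := rfl
  have hlin : ∀ a b : E, A ((1 / 2 : ℝ) • a - (1 / 2 : ℝ) • b) =
      (1 / 2 : ℝ) • A a - (1 / 2 : ℝ) • A b := fun a b => by
    rw [map_sub, map_smul, map_smul]
  refine (congrArg (fun v : E => A v) hco).trans ((hlin _ _).trans ?_)
  exact congrArg₂ (fun a b : F => (1 / 2 : ℝ) • a - (1 / 2 : ℝ) • b)
    (congrArg (fun v : E => A v) hder) hproj

end Main

end

end HomogeneousSpray

/-! ### The covariant derivative in the moving frame, and the theorem -/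

namespace HomogeneousSpray

noncomputable section

variable {E : Type*} [NormedAddCommGroup E] [NormedSpace ℝ E] [FiniteDimensional ℝ E]
  {F : Type*} [NormedAddCommGroup F] [NormedSpace ℝ F] [FiniteDimensional ℝ F]
  {G : Type*} [TopologicalSpace G] [ChartedSpace E G] [Group G] [LieGroup 𝓘(ℝ, E) ∞ G]
  {H : Subgroup G} [ChartedSpace F (G ⧸ H)] [IsManifold 𝓘(ℝ, F) ∞ (G ⧸ H)]
  {m : Submodule ℝ (GroupLieAlgebra 𝓘(ℝ, E) G)}
  {e : OpenPartialHomeomorph (G ⧸ H) F}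

/-- In the coordinates of `e`, the derivative of a smooth field `(c̄(t))_* (y(t))` with `y(t) ∈ 𝔪`
along the projection of `c̄`. -/
theorem hasDerivAt_tangentChart_push (hGH : IsSmoothCosetSpace E F H)
    (hm : IsCompl (subgroupLieAlgebra E H) m)
    (he : e ∈ IsManifold.maximalAtlas 𝓘(ℝ, F) ∞ (G ⧸ H)) {γ : ℝ → G} {t : ℝ}
    (hγ : MDifferentiableAt 𝓘(ℝ, ℝ) 𝓘(ℝ, E) γ t)
    (hte : (QuotientGroup.mk (γ t) : G ⧸ H) ∈ e.source)
    {Y : ℝ → TangentBundle 𝓘(ℝ, F) (G ⧸ H)}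
    (hY : MDifferentiableAt 𝓘(ℝ, ℝ) 𝓘(ℝ, F).tangent Y t) {y : ℝ → m}
    (hy : ∀ᶠ s in 𝓝 t, Y s = push (γ s) (toOrigin H (y s : GroupLieAlgebra 𝓘(ℝ, E) G))) :
    HasDerivAt (fun s => (tangentChart e (Y s)).2)
      ((leftDeriv (leftDeriv (cosetChart e) : G → E →L[ℝ] F) (γ t) : E →L[ℝ] E →L[ℝ] F)
          (leftVelocity γ t) (y t : GroupLieAlgebra 𝓘(ℝ, E) G) +
        (leftDeriv (cosetChart e) (γ t) : E →L[ℝ] F)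
          ((deriv y t : m) : GroupLieAlgebra 𝓘(ℝ, E) G)) t := by
  have : CompleteSpace F := FiniteDimensional.complete ℝ F
  have hU := isOpen_mk_preimage_source (e := e) hGH
  have hf := contMDiffOn_cosetChart hGH he
  let z : ℝ → E := fun s => (y s : GroupLieAlgebra 𝓘(ℝ, E) G)
  have hev : (fun s => (tangentChart e (Y s)).2) =ᶠ[𝓝 t]
      fun s => (leftDeriv (cosetChart e) (γ s) : E →L[ℝ] F) (z s) := by
    filter_upwards [hy, hγ.continuousAt.eventually_mem (hU.mem_nhds hte)] with s hs hse
    rw [hs]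
    exact tangentChart_push_toOrigin hGH he hse _
  have hYt : (Y t).1 ∈ e.source := by
    rw [hy.self_of_nhds]
    have h : γ t • origin H ∈ e.source := by
      rw [smul_origin]
      exact hte
    exact h
  have h1 : DifferentiableAt ℝ (fun s => (tangentChart e (Y s)).2) t :=
    ((mdifferentiableAt_tangentChart he hYt).comp t hY).differentiableAt.snd
  have h2 : MDifferentiableAt 𝓘(ℝ, E) 𝓘(ℝ, E →L[ℝ] F)
      (leftDeriv (cosetChart e) : G → E →L[ℝ] F) (γ t) :=
    ((contMDiffOn_leftDeriv hU hf).contMDiffAt (hU.mem_nhds hte)).mdifferentiableAt (by simp)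
  obtain ⟨R, -, hR, hR'⟩ := exists_rightInverse_leftDeriv_cosetChart hGH he hte hm
  -- Only `Y` is given as smooth. Differentiability of `y` is recovered from it, so `deriv y t` is a
  -- genuine derivative and not the default value.
  have hz : DifferentiableAt ℝ z t :=
    differentiableAt_of_clm_apply (hasDerivAt_comp_leftDeriv hγ h2).differentiableAt
      (hev.differentiableAt_iff.1 h1) hR (Filter.Eventually.of_forall fun s => hR' _ (y s).2)
  have hz' : ((deriv y t : m) : GroupLieAlgebra 𝓘(ℝ, E) G) = deriv z t :=
    coe_deriv_eq_of_hasDerivAt (E := E) m hz.hasDerivAt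
  rw [hz']
  exact (hasDerivAt_leftDeriv_apply hU hf hγ hte hz.hasDerivAt).congr_of_eventuallyEq hev

/-- The nonlinear covariant derivative of `(c̄(t))_* (y(t))` along the projection of `c̄`, where
`y(t) ∈ 𝔪`, is `(c̄(t))_* (y'(t) + N(y(t), w(t)))`. -/
theorem nonlinearCovariantDeriv_push (hGH : IsSmoothCosetSpace E F H)
    (hm : IsCompl (subgroupLieAlgebra E H) m) {S : Spray F (G ⧸ H)} (hS : IsInvariant S)
    (he : e ∈ IsManifold.maximalAtlas 𝓘(ℝ, F) ∞ (G ⧸ H)) {γ : ℝ → G} {t : ℝ}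
    (hγ : MDifferentiableAt 𝓘(ℝ, ℝ) 𝓘(ℝ, E) γ t)
    (hte : (QuotientGroup.mk (γ t) : G ⧸ H) ∈ e.source)
    {c : ℝ → G ⧸ H} (hc : ∀ᶠ s in 𝓝 t, c s = QuotientGroup.mk (γ s))
    {Y : ℝ → TangentBundle 𝓘(ℝ, F) (G ⧸ H)}
    (hY : MDifferentiableAt 𝓘(ℝ, ℝ) 𝓘(ℝ, F).tangent Y t) {y : ℝ → m}
    (hy : ∀ᶠ s in 𝓝 t, Y s = push (γ s) (toOrigin H (y s : GroupLieAlgebra 𝓘(ℝ, E) G)))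
    (hyt : y t ≠ 0) {w : m} (hw : (w : GroupLieAlgebra 𝓘(ℝ, E) G) = leftVelocity γ t) :
    nonlinearCovariantDeriv S e c Y t = (leftDeriv (cosetChart e) (γ t) : E →L[ℝ] F)
      ((deriv y t + connectionOperator S m hm (y t) w : m) : GroupLieAlgebra 𝓘(ℝ, E) G) := by
  obtain ⟨η, hη, hη'⟩ := exists_sprayVectorField_eq hGH hS hm
  have hyt' : (y t : GroupLieAlgebra 𝓘(ℝ, E) G) ≠ 0 := fun h => hyt (Subtype.ext h)
  have hdη := (hη' _ (y t).2 hyt').1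
  set A : E →L[ℝ] F := leftDeriv (cosetChart e) (γ t) with hA
  set D : E →L[ℝ] E →L[ℝ] F :=
    leftDeriv (leftDeriv (cosetChart e) : G → E →L[ℝ] F) (γ t) with hD
  let y₀ : E := (y t : GroupLieAlgebra 𝓘(ℝ, E) G)
  let u : E := (w : GroupLieAlgebra 𝓘(ℝ, E) G)
  have h1 : deriv (fun s => (tangentChart e (Y s)).2) t =
      D u y₀ + A ((deriv y t : m) : GroupLieAlgebra 𝓘(ℝ, E) G) :=
    (hasDerivAt_tangentChart_push hGH hm he hγ hte hY hy).deriv.trans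
      (congrArg (fun a : E => D a y₀ + A ((deriv y t : m) : GroupLieAlgebra 𝓘(ℝ, E) G)) hw.symm)
  have h2 : deriv (fun s => e (c s)) t = A u := by
    have h3 : HasDerivAt (fun s => e (c s)) (A (leftVelocity γ t)) t :=
      (hasDerivAt_comp_leftDeriv hγ (mdifferentiableAt_cosetChart hGH he hte)).congr_of_eventuallyEq
        (hc.mono fun s hs => congrArg e hs)
    exact h3.deriv.trans (congrArg (fun a : E => A a) hw.symm)
  have h3 : (tangentChart e (Y t)).2 = A y₀ := by
    rw [hy.self_of_nhds]
    exact tangentChart_push_toOrigin hGH he hte _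
  have hAy : A y₀ ≠ 0 := fun h => hyt' (Submodule.disjoint_def.1 hm.disjoint _
    ((leftDeriv_cosetChart_eq_zero_iff hGH he hte _).1 h) (y t).2)
  have h4 : ∀ᶠ s in 𝓝 (0 : ℝ), SprayEquation (E := E) S e (γ t) (y₀ + s • u) (η (y₀ + s • u)) := by
    have hne : ∀ᶠ s : ℝ in 𝓝 0, y₀ + s • u ≠ 0 := by
      refine ContinuousAt.eventually_ne (by fun_prop) ?_
      rw [zero_smul, add_zero]
      exact hyt'
    filter_upwards [hne] with s hs
    exact (hη' _ (y t + s • w).2 hs).2 e he _ hte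
  have h5 := connectionCoefficient_leftDeriv he hte hdη hAy h4
  have h6 := leftDeriv_connectionOperator hGH hm he hte hyt w hdη hη
  have h7 : nonlinearCovariantDeriv S e c Y t =
      D u y₀ + A ((deriv y t : m) : GroupLieAlgebra 𝓘(ℝ, E) G) +
        connectionCoefficient S e (cosetChart e (γ t)) (A y₀) (A u) := by
    rw [nonlinearCovariantDeriv, h1, h2, h3, hc.self_of_nhds]
    rfl
  rw [h7]
  refine (congrArg (fun a => D u y₀ + A ((deriv y t : m) : GroupLieAlgebra 𝓘(ℝ, E) G) + a)
    h5).trans (Eq.trans ?_ ((congrArg (fun a => A ((deriv y t : m) : GroupLieAlgebra 𝓘(ℝ, E) G) + a)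
    h6).symm.trans (map_add A _ _).symm))
  -- The term `D u y₀` from differentiating the field loses half of itself to the symmetric part,
  -- and the rest is `-½ (D y₀ u - D u y₀)`, the bracket term.
  change D u y₀ + _ + -(1 / 2 : ℝ) • (D u y₀ + D y₀ u - A (fderiv ℝ η y₀ u)) =
    _ + ((1 / 2 : ℝ) • A (fderiv ℝ η y₀ u) - (1 / 2 : ℝ) • (D y₀ u - D u y₀))
  module

end

end HomogeneousSpray

theorem theorem6p2
    {E : Type*} [NormedAddCommGroup E] [NormedSpace ℝ E] [FiniteDimensional ℝ E]
    {F : Type*} [NormedAddCommGroup F] [NormedSpace ℝ F] [FiniteDimensional ℝ F]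
    {G : Type*} [TopologicalSpace G] [ChartedSpace E G] [Group G] [LieGroup 𝓘(ℝ, E) ∞ G]
    (H : Subgroup G) (hH : IsClosed (H : Set G))
    [ChartedSpace F (G ⧸ H)] [IsManifold 𝓘(ℝ, F) ∞ (G ⧸ H)] (hGH : IsSmoothCosetSpace E F H)
    (m : Submodule ℝ (GroupLieAlgebra 𝓘(ℝ, E) G)) (hm : IsCompl (subgroupLieAlgebra E H) m)
    (S : Spray F (G ⧸ H)) (hS : IsInvariant S)
    (J : Set ℝ) (hJ : IsOpen J) (hJ' : J.OrdConnected) (h0 : (0 : ℝ) ∈ J)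
    (c : ℝ → G ⧸ H) (hc : ContMDiffOn 𝓘(ℝ, ℝ) 𝓘(ℝ, F) ∞ c J) (hc0 : c 0 = origin H)
    (hc' : ∀ t ∈ J, velocity c t ∈ slit F (G ⧸ H))
    (cbar : ℝ → G) (hcbar : IsLiftOn m c cbar J)
    (w : ℝ → m) (hw : ∀ t ∈ J, (w t : GroupLieAlgebra 𝓘(ℝ, E) G) = leftVelocity cbar t)
    (Y : ℝ → TangentBundle 𝓘(ℝ, F) (G ⧸ H)) (hY : IsNonvanishingFieldAlong c Y J)
    (y : ℝ → m) (hy : ∀ t ∈ J, Y t = push (cbar t) (toOrigin H (y t : GroupLieAlgebra 𝓘(ℝ, E) G))) :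
    IsNonlinearlyParallelOn S c Y J ↔
      ∀ t ∈ J, deriv y t + connectionOperator S m hm (y t) (w t) = 0 := by
  have hproj : ∀ t ∈ J, c t = QuotientGroup.mk (cbar t) := fun t ht =>
    (hcbar.proj t ht).trans (smul_origin _)
  -- The right-hand side is independent of the chart, so being parallel in one chart around each
  -- point is the same as in all of them.
  have key : ∀ t ∈ J, ∀ e ∈ IsManifold.maximalAtlas 𝓘(ℝ, F) ∞ (G ⧸ H), c t ∈ e.source →
      (nonlinearCovariantDeriv S e c Y t = 0 ↔
        deriv y t + connectionOperator S m hm (y t) (w t) = 0) := by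
    intro t ht e he hte
    rw [hproj t ht] at hte
    have hJt : J ∈ 𝓝 t := hJ.mem_nhds ht
    have hyt : y t ≠ 0 := by
      intro h
      have hYt : (Y t).1 ∈ e.source := by
        rw [hY.proj t ht, hproj t ht]
        exact hte
      refine hY.mem_slit t ht ((tangentChart_snd_eq_zero_iff he hYt).1 ?_)
      rw [hy t ht, tangentChart_push_toOrigin hGH he hte, h]
      exact ContinuousLinearMap.map_zero (leftDeriv (cosetChart e) (cbar t) : E →L[ℝ] F)
    rw [nonlinearCovariantDeriv_push hGH hm hS he
      ((hcbar.smooth.contMDiffAt hJt).mdifferentiableAt (by simp)) hte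
      (Filter.eventually_of_mem hJt hproj)
      ((hY.smooth.contMDiffAt hJt).mdifferentiableAt (by simp))
      (Filter.eventually_of_mem hJt hy) hyt (hw t ht),
      leftDeriv_cosetChart_eq_zero_iff hGH he hte]
    constructor
    · intro h
      exact Subtype.ext (Submodule.disjoint_def.1 hm.disjoint _ h (SetLike.coe_mem _))
    · intro h
      rw [h]
      exact Submodule.zero_mem _
  constructor
  · intro h t ht
    have he := IsManifold.chart_mem_maximalAtlas (I := 𝓘(ℝ, F)) (n := ∞) (c t)
    have hte := mem_chart_source F (c t)
    exact (key t ht _ he hte).1 (h t ht _ he hte)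
  · intro h t ht e he hte
    exact (key t ht e he hte).2 (h t ht)
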